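/- **Conventions.** $\lambda$ is the security parameter, $\bot\notin\{0,1\}^*$ is a special symbol, and "PPT" means non-uniform probabilistic polynomial time (families of probabilistic Boolean circuits of polynomial size; every PPT algorithm in the uniform sense is such a family). Random coins of key generation, encryption and commitment are uniform in $\{0,1\}^\lambda$. A function of $\lambda$ is negligible if it is eventually smaller than the inverse of every polynomial. **Parameters.** Let $N>0$, let $\mathcal M,\Sigma\subseteq\{0,1\}^*$, and let $F:(\mathcal M\cup\{\bot\})^N\to\Sigma\cup\{\bot\}$ be a tally function, i.e. $F(m_1,\dots,m_N)=\bot$ iff $m_1=\dots=m_N=\bot$. Assume that $(x_1,\dots,x_N)\mapsto F(\bar x_1,\dots,\bar x_N)$, where $\bar x=x$ if $x\in\mathcal M$ and $\bar x=\bot$ otherwise, is computable in (non-uniform) polynomial time (automatic if $\mathcal M$ is finite). **Building blocks.** * $\mathcal E=(\mathsf{Setup},\mathsf{Encrypt},\mathsf{Decrypt})$ is a PPT public key encryption scheme whose message space contains $\mathcal M\cup\{\bot\}$. It is perfectly correct ($\mathsf{Decrypt}$ always recovers an encrypted message of the message space, for honestly generated keys), has unique secret keys (for each $\mathsf{Pk}$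 there is at most one $\mathsf{Sk}$ with $(\mathsf{Pk},\mathsf{Sk})\in\mathsf{Setup}(1^\lambda)$), and is IND-CPA secure: for every PPT adversary that on input $\mathsf{Pk}$ chooses two messages $m_0,m_1$ in the message space, the probabilities that it outputs $1$ when it is then given an encryption of $m_0$, respectively of $m_1$, differ negligibly. * $\mathsf{Com}$ is a polynomial-time commitment scheme that is perfectly binding ($\mathsf{Com}(x_0;r_0)\ne\mathsf{Com}(x_1;r_1)$ if $x_0\neq x_1$) and computationally hiding (for strings $x_0,x_1$ of the same length, $\mathsf{Com}(x_0)$ and $\mathsf{Com}(x_1)$ are computationally indistinguishable). * $\mathsf{NIWI}^{\mathsf{enc}}$ and $\mathsf{NIWI}^{\mathsf{dec}}$ are one-message non-interactive proof systems for the relations $R^{\mathsf{enc}}$ and $R^{\mathsf{dec}}$ below, with PPT prover and deterministic polynomial-time verifier, perfectly complete, perfectly sound and witness-indistinguishable (for $x,w_0,w_1$ of polynomial size with $(x,w_0),(x,w_1)\in R$, proofs computed with $w_0$ and with $w_1$ are computationally indistinguishable). $R^{\mathsf{enc}}$ holds for $x=(j,(\mathsf{Ct}_l)_{l\le3},(\mathsf{Pk}_l)_{l\le3},Z)$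 and $w=(m,r_1,r_2,r_3,u)$ iff either $m\in\mathcal M\cup\{\bot\}$ and $\mathsf{Ct}_l=\mathsf{Encrypt}(\mathsf{Pk}_l,m;r_l)$ for all $l$, or $Z=\mathsf{Com}(0;u)$ (with $r_l,u\in\{0,1\}^\lambda$). $R^{\mathsf{dec}}$ holds for $x=(\mathsf{Blt}_1,\dots,\mathsf{Blt}_N,(\mathsf{Pk}_l)_{l\le3},y)$ and $w=(\mathsf{Sk}'_1,\mathsf{Sk}'_2,s_1,s_2,i_1,i_2)$ iff $i_1<i_2$; $\mathsf{Setup}(1^\lambda;s_l)=(\mathsf{Pk}_{i_l},\mathsf{Sk}'_l)$ with $s_l\in\{0,1\}^\lambda$ for $l\in\{1,2\}$; and $y=\bot$ or, for both $l$, $y=F(m_1^{l},\dots,m_N^{l})$, where $m_j^{l}=\bot$ if $\mathsf{Blt}_j=\bot$ or if $\mathsf{Decrypt}(\mathsf{Ct}_{j,i_l},\mathsf{Sk}'_l)\notin\mathcal M$, and $m_j^{l}=\mathsf{Decrypt}(\mathsf{Ct}_{j,i_l},\mathsf{Sk}'_l)$ otherwise. **The scheme $\mathsf{EVOTE}_{\mathsf{full}}$.**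 * $\mathsf{Setup}(1^\lambda)$: $Z=\mathsf{Com}(1;r)$ and $(\mathsf{Pk}_l,\mathsf{Sk}_l)=\mathcal E.\mathsf{Setup}(1^\lambda;s_l)$ for $l\le 3$; the public key is $\mathsf{Pk}=(\mathsf{Pk}_1,\mathsf{Pk}_2,\mathsf{Pk}_3,Z)$ and the secret key is $\mathsf{Sk}=(\mathsf{Sk}_1,\mathsf{Sk}_2,s_1,s_2,r)$. * $\mathsf{Cast}(\mathsf{Pk},j,v)$: $(\mathsf{Ct}_1,\mathsf{Ct}_2,\mathsf{Ct}_3,\pi)$ with $\mathsf{Ct}_l=\mathsf{Encrypt}(\mathsf{Pk}_l,v;r_l)$ and $\pi$ a $\mathsf{NIWI}^{\mathsf{enc}}$ proof computed with the witness $(v,r_1,r_2,r_3)$. * $\mathsf{VerifyBallot}(\mathsf{Pk},j,\mathsf{Blt})$ verifies this proof. * $\mathsf{EvalTally}$ replaces by $\bot$ the ballots that are not accepted by $\mathsf{VerifyBallot}$. If all are $\bot$ it outputs $(\bot,\bot)$. Otherwise it computes the tallies $y_1,y_2$ obtained by decrypting the first, respectively the second, ciphertexts (decryptions outside $\mathcal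 M$ and ballots equal to $\bot$ counting as $\bot$), sets $y=y_1$ if $y_1=y_2$ and $y=\bot$ otherwise, and outputs $y$ with a $\mathsf{NIWI}^{\mathsf{dec}}$ proof $\gamma$ computed with the witness $(\mathsf{Sk}_1,\mathsf{Sk}_2,s_1,s_2,1,2)$. * $\mathsf{VerifyTally}$ does the same replacement; for $y=\bot$ it accepts iff all ballots are then $\bot$; for $y\ne\bot$ it verifies the $\mathsf{NIWI}^{\mathsf{dec}}$ proof. **The privacy game.** The challenger generates $(\mathsf{Pk},\mathsf{Sk})$ and a uniform bit $b$. The adversary $\mathcal A$, given $\mathsf{Pk}$, outputs tuples $(m_{0,j})_{j\le N}$, $(m_{1,j})_{j\le N}$ and a set $S\subseteq[N]$; entries with $j\in S$ are arbitrary ballots or $\bot$, the others are votes. For $j\in S$, $\mathsf{Blt}_j=m_{b,j}$, replaced by $\bot$ if $\mathsf{VerifyBallot}$ rejects it; for $j\notin S$, $\mathsf{Blt}_j\leftarrow\mathsf{Cast}(\mathsf{Pk},j,m_{b,j})$. $\mathcal A$ receives all $\mathsf{Blt}_j$ and $(y,\gamma)\leftarrow\mathsf{EvalTally}(\mathsf{Pk},\mathsf{Sk},\mathsf{Blt}_1,\dots,\mathsf{Blt}_N)$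 and outputs $b'$. It wins iff $b'=b$ and its challenge is valid: (i) $m_{0,j}=m_{1,j}$ for $j\in S$; (ii) $m_{0,j},m_{1,j}\in\mathcal M\cup\{\bot\}$ for $j\notin S$; (iii) for all $d_1,\dots,d_N\in\mathcal M\cup\{\bot\}$, $F(m'_{0,1},\dots,m'_{0,N})=F(m'_{1,1},\dots,m'_{1,N})$, where $m'_{b,j}=d_j$ for $j\in S$ and $m'_{b,j}=m_{b,j}$ for $j\notin S$. **Theorem.** Under these assumptions $\mathsf{EVOTE}_{\mathsf{full}}$ is $\mathsf{IND}$-secure: for every PPT adversary $\mathcal A$ there is a negligible $\nu$ such that $\Pr[\mathcal A\text{ wins}]-\tfrac12\le\nu(\lambda)$ for all $\lambda$, and if moreover the challenges of $\mathcal A$ are always valid, then $\left|\Pr[\mathcal A\text{ wins}]-\tfrac12\right|$ is negligible. -/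

import Mathlib

open Filter Topology

noncomputable section

namespace EVoting

/-! ### Binary data and non-uniform probabilistic polynomial time -/

/-- Binary strings, the elements of `{0,1}^*`. The special symbol `⊥ ∉ {0,1}^*` is represented by
`none : Option Str`. -/
abbrev Str := List Bool

/-- A type whose elements are written in binary: `bit a` lists the bits of `a`, padded with zeros
after position `size a`. Distinct elements have distinct encodings. -/
class Coded (α : Type) where
  size : α → ℕ
  bit : α → ℕ → Bool
  bit_eq_false : ∀ (a : α) (i : ℕ), size a ≤ i → bit a i = false
  bit_injective : Function.Injective bit

instance : Coded Bool where
  size _ := 1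
  bit b i := b && decide (i = 0)
  bit_eq_false b i h := by simp; omega
  bit_injective a b h := by simpa using congrFun h 0

/-- Elements of `{0, …, k-1}`, one-hot. -/
instance (k : ℕ) : Coded (Fin k) where
  size _ := k
  bit j i := decide (i = j.val)
  bit_eq_false j i h := by simp; omega
  bit_injective a b h := by simpa [Fin.ext_iff] using congrFun h a.val

/-- Strings: the pair of positions `2 * i`, `2 * i + 1` tells whether there is an `i`-th letter and
what it is. -/
instance : Coded Str where
  size x := 2 * x.length
  bit x i := if i % 2 = 0 then decide (i / 2 < x.length) else x.getD (i / 2) false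
  bit_eq_false x i h := by
    have h2 : x.length ≤ i / 2 := by omega
    split_ifs
    · simpa using h2
    · rw [List.getD_eq_default _ _ h2]
  bit_injective x y h := by
    have hlt : ∀ i, i < x.length ↔ i < y.length := fun i => by
      have h1 := congrFun h (2 * i)
      have h2 : 2 * i / 2 = i := by omega
      simpa [h2] using h1
    have hl : x.length = y.length := by
      have h1 := hlt x.length
      have h2 := hlt y.length
      omega
    refine List.ext_getElem hl fun i hx hy => ?_
    have h1 := congrFun h (2 * i + 1)
    have h2 : (2 * i + 1) / 2 = i := by omega
    have h3 : (2 * i + 1) % 2 = 1 := by omega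
    simpa [h2, h3, List.getElem?_eq_getElem hx, List.getElem?_eq_getElem hy] using h1

/-- Optional data: the first bit is a flag. -/
instance {α : Type} [Coded α] : Coded (Option α) where
  size o := o.elim 0 fun a => Coded.size a + 1
  bit o i := o.elim false fun a => if i = 0 then true else Coded.bit a (i - 1)
  bit_eq_false o i h := by
    cases o with
    | none => rfl
    | some a =>
      simp only [Option.elim] at h ⊢
      rw [if_neg (by omega)]
      exact Coded.bit_eq_false a _ (by omega)
  bit_injective o o' h := by
    cases o <;> cases o'
    · rfl
    · simpa using congrFun h 0
    · simpa using congrFun h 0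
    · rename_i a b
      have : Coded.bit a = Coded.bit b := funext fun i => by simpa using congrFun h (i + 1)
      rw [Coded.bit_injective this]

/-- Pairs: the two encodings are interleaved. -/
instance {α β : Type} [Coded α] [Coded β] : Coded (α × β) where
  size x := 2 * max (Coded.size x.1) (Coded.size x.2)
  bit x i := if i % 2 = 0 then Coded.bit x.1 (i / 2) else Coded.bit x.2 (i / 2)
  bit_eq_false x i h := by
    split_ifs
    · exact Coded.bit_eq_false _ _ (by omega)
    · exact Coded.bit_eq_false _ _ (by omega)
  bit_injective x y h := by
    refine Prod.ext (Coded.bit_injective (funext fun i => ?_))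
      (Coded.bit_injective (funext fun i => ?_))
    · have h1 := congrFun h (2 * i)
      have h2 : 2 * i / 2 = i := by omega
      simpa [h2] using h1
    · have h1 := congrFun h (2 * i + 1)
      have h2 : (2 * i + 1) / 2 = i := by omega
      have h3 : (2 * i + 1) % 2 = 1 := by omega
      simpa [h2, h3] using h1

/-- Tuples: the encodings of the components are interleaved. -/
instance {k : ℕ} {α : Type} [Coded α] : Coded (Fin k → α) where
  size f := k * Finset.univ.sup fun j => Coded.size (f j)
  bit f i := if h : 0 < k then Coded.bit (f ⟨i % k, Nat.mod_lt _ h⟩) (i / k) else false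
  bit_eq_false f i hi := by
    split_ifs with h
    · refine Coded.bit_eq_false _ _ ?_
      refine le_trans (Finset.le_sup (f := fun j => Coded.size (f j)) (Finset.mem_univ _)) ?_
      rw [Nat.le_div_iff_mul_le h, mul_comm]
      exact hi
    · rfl
  bit_injective f g hfg := by
    funext j
    refine Coded.bit_injective (funext fun i => ?_)
    have hk : 0 < k := lt_of_le_of_lt (Nat.zero_le _) j.isLt
    have h1 := congrFun hfg (j.val + k * i)
    have h2 : (j.val + k * i) % k = j.val := by
      rw [Nat.add_mul_mod_self_left, Nat.mod_eq_of_lt j.isLt]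
    have h3 : (j.val + k * i) / k = i := by
      rw [Nat.add_mul_div_left _ _ hk, Nat.div_eq_of_lt j.isLt, zero_add]
    simpa [hk, h2, h3] using h1

/-- Pairs of data indexed by a bit. -/
instance {α : Type} [Coded α] : Coded (Bool → α) where
  size f := 2 * max (Coded.size (f false)) (Coded.size (f true))
  bit f i := if i % 2 = 0 then Coded.bit (f false) (i / 2) else Coded.bit (f true) (i / 2)
  bit_eq_false f i h := by
    split_ifs
    · exact Coded.bit_eq_false _ _ (by omega)
    · exact Coded.bit_eq_false _ _ (by omega)
  bit_injective f g h := by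
    funext b
    refine Coded.bit_injective (funext fun i => ?_)
    cases b
    · have h1 := congrFun h (2 * i)
      have h2 : 2 * i / 2 = i := by omega
      simpa [h2] using h1
    · have h1 := congrFun h (2 * i + 1)
      have h2 : (2 * i + 1) / 2 = i := by omega
      have h3 : (2 * i + 1) % 2 = 1 := by omega
      simpa [h2, h3] using h1

/-- Boolean circuits over the basis `NAND`, with input wires `inp`. A circuit is a list of gates,
the latest gate first; every gate is an input wire, a constant, or the `NAND` of two earlier gates,
and it is recorded as the Boolean function of the input that it computes. -/
inductive IsCircuit {X : Type} (inp : Set (X → Bool)) : List (X → Bool) → Prop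
  | nil : IsCircuit inp []
  | input {L : List (X → Bool)} {g : X → Bool} :
      g ∈ inp → IsCircuit inp L → IsCircuit inp (g :: L)
  | const {L : List (X → Bool)} (b : Bool) :
      IsCircuit inp L → IsCircuit inp ((fun _ => b) :: L)
  | nand {L : List (X → Bool)} {g h : X → Bool} :
      g ∈ L → h ∈ L → IsCircuit inp L → IsCircuit inp ((fun x => !(g x && h x)) :: L)

/-- Non-uniform probabilistic polynomial time. The randomized algorithm `f` has, for every security
parameter `κ` and every bound `n` on the size of the input, a Boolean circuit with polynomially many
gates in `κ + n` that reads the bits of an input `a` of size at most `n` and `c` uniformly random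
bits, and whose output bits are those of a random variable `g a` with distribution `f κ a`. -/
def PPT {α β : Type} [Coded α] [Coded β] (f : ℕ → α → PMF β) : Prop :=
  ∃ p : Polynomial ℕ, ∀ κ n : ℕ,
    ∃ (c : ℕ) (g : {a : α // Coded.size a ≤ n} → (Fin c → Bool) → β)
      (L : List ({a : α // Coded.size a ≤ n} × (Fin c → Bool) → Bool)),
      IsCircuit (Set.range (fun (i : ℕ) x => Coded.bit x.1.1 i) ∪
        Set.range (fun (i : Fin c) x => x.2 i)) L ∧
      c + L.length ≤ p.eval (κ + n) ∧
      (∀ i : ℕ, (fun x => Coded.bit (g x.1 x.2) i) ∈ L) ∧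
      (∀ a r, Coded.size (g a r) ≤ p.eval (κ + n)) ∧
      ∀ a, (PMF.uniformOfFintype (Fin c → Bool)).map (g a) = f κ a.1

/-- (Non-uniform) polynomial time, for deterministic algorithms. -/
def PolyTime {α β : Type} [Coded α] [Coded β] (f : ℕ → α → β) : Prop :=
  PPT fun κ a => PMF.pure (f κ a)

/-- A negligible function vanishes faster than the inverse of any polynomial. -/
def Negligible (ν : ℕ → ℝ) : Prop :=
  Asymptotics.SuperpolynomialDecay atTop (fun κ : ℕ => (κ : ℝ)) ν

/-- The probability that an experiment outputs `1`. -/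
def Pr (p : PMF Bool) : ℝ := (p true).toReal

/-- A uniformly random string in `{0,1}^κ`. -/
def coins (κ : ℕ) : PMF Str := (PMF.uniformOfFintype (Fin κ → Bool)).map List.ofFn

/-- Independent samples of the distributions `p 0, …, p (k-1)`. -/
def sampleAll {α : Type} : {k : ℕ} → (Fin k → PMF α) → PMF (Fin k → α)
  | 0, _ => PMF.pure Fin.elim0
  | _ + 1, p => do
    let a ← p 0
    let v ← sampleAll fun i => p i.succ
    pure (Fin.cons a v)

/-! ### Public key encryption -/

/-- A public key encryption scheme with message space `msg`. The random coins of `setup` and of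
`encrypt`, strings in `{0,1}^κ`, are explicit. -/
structure PKE where
  /-- message space -/
  msg : Set (Option Str)
  /-- `setup κ s = (Pk, Sk)` -/
  setup : ℕ → Str → Str × Str
  /-- `encrypt κ Pk m r = Ct` -/
  encrypt : ℕ → Str → Option Str → Str → Str
  /-- `decrypt κ Sk Ct = m` -/
  decrypt : ℕ → Str → Str → Option Str

namespace PKE

variable (E : PKE)

/-- The three algorithms run in polynomial time. -/
structure Efficient : Prop where
  setup : PolyTime fun κ (s : Str) => E.setup κ s
  encrypt : PolyTime fun κ (x : Str × Option Str × Str) => E.encrypt κ x.1 x.2.1 x.2.2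
  decrypt : PolyTime fun κ (x : Str × Str) => E.decrypt κ x.1 x.2

def PerfectlyCorrect : Prop :=
  ∀ (κ : ℕ) (s r : Str), s.length = κ → r.length = κ → ∀ m ∈ E.msg,
    E.decrypt κ (E.setup κ s).2 (E.encrypt κ (E.setup κ s).1 m r) = m

def UniqueSecretKey : Prop :=
  ∀ (κ : ℕ) (s s' : Str), s.length = κ → s'.length = κ →
    (E.setup κ s).1 = (E.setup κ s').1 → (E.setup κ s).2 = (E.setup κ s').2

/-- A two-stage chosen-plaintext adversary: on input the public key it chooses a pair of messages
and a state `σ`; then it sees a challenge ciphertext and outputs a bit. -/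
structure CPAAdversary (σ : Type) where
  choose : ℕ → Str → PMF ((Bool → Option Str) × σ)
  guess : ℕ → σ × Str → PMF Bool

/-- The adversary is PPT and its messages belong to the message space. -/
structure CPAAdversary.Legal {σ : Type} [Coded σ] (A : CPAAdversary σ) : Prop where
  choose : PPT A.choose
  guess : PPT A.guess
  mem_msg : ∀ κ pk, ∀ x ∈ (A.choose κ pk).support, ∀ b, x.1 b ∈ E.msg

/-- The output of the adversary when the `b`-th message is encrypted. -/
def cpaGame {σ : Type} (A : CPAAdversary σ) (b : Bool) (κ : ℕ) : PMF Bool := do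
  let s ← coins κ
  let x ← A.choose κ (E.setup κ s).1
  let r ← coins κ
  A.guess κ (x.2, E.encrypt κ (E.setup κ s).1 (x.1 b) r)

def INDCPA : Prop :=
  ∀ (σ : Type) [Coded σ] (A : CPAAdversary σ), A.Legal E →
    Negligible fun κ => |Pr (E.cpaGame A false κ) - Pr (E.cpaGame A true κ)|

end PKE

/-! ### Commitments -/

/-- `com κ x r`, for `r ∈ {0,1}^κ`, is a perfectly binding and computationally hiding commitment
scheme. -/
structure IsCommitment (com : ℕ → Str → Str → Str) : Prop where
  efficient : PolyTime fun κ (x : Str × Str) => com κ x.1 x.2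
  perfectly_binding : ∀ (κ : ℕ) (x₀ x₁ r₀ r₁ : Str), r₀.length = κ → r₁.length = κ → x₀ ≠ x₁ →
    com κ x₀ r₀ ≠ com κ x₁ r₁
  computationally_hiding : ∀ x₀ x₁ : Str, x₀.length = x₁.length → ∀ A : ℕ → Str → PMF Bool, PPT A →
    Negligible fun κ => |Pr ((coins κ).bind fun r => A κ (com κ x₀ r)) -
      Pr ((coins κ).bind fun r => A κ (com κ x₁ r))|

/-! ### One-message proof systems -/

/-- A (one-message) non-interactive proof system with statements in `X` and witnesses in `W`. -/
structure ProofSystem (X W : Type) where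
  prove : ℕ → X → W → PMF Str
  verify : ℕ → X → Str → Bool

/-- `P` is a NIWI for the relation `R`: efficient, perfectly complete, perfectly sound, and
witness-indistinguishable. -/
structure IsNIWI {X W : Type} [Coded X] [Coded W] (R : ℕ → X → W → Prop)
    (P : ProofSystem X W) : Prop where
  prove_efficient : PPT fun κ (x : X × W) => P.prove κ x.1 x.2
  verify_efficient : PolyTime fun κ (x : X × Str) => P.verify κ x.1 x.2
  complete : ∀ κ x w, R κ x w → ∀ π ∈ (P.prove κ x w).support, P.verify κ x π = true
  sound : ∀ κ x π, P.verify κ x π = true → ∃ w, R κ x w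
  witness_indistinguishable : ∀ D : ℕ → Str → PMF Bool, PPT D → ∀ q : Polynomial ℕ,
    ∃ ν : ℕ → ℝ, Negligible ν ∧ ∀ (κ : ℕ) (x : X) (w₀ w₁ : W),
      Coded.size (x, w₀, w₁) ≤ q.eval κ → R κ x w₀ → R κ x w₁ →
        |Pr ((P.prove κ x w₀).bind (D κ)) - Pr ((P.prove κ x w₁).bind (D κ))| ≤ ν κ

/-! ### E-voting schemes and their privacy -/

/-- `M ∪ {⊥}` -/
def votes (M : Set Str) : Set (Option Str) := {v | ∀ x ∈ v, x ∈ M}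

open Classical in
/-- Replaces everything that is not in `M` by `⊥`. -/
def clean (M : Set Str) (v : Option Str) : Option M :=
  v.bind fun x => if h : x ∈ M then some ⟨x, h⟩ else none

/-- The tally function outputs `⊥` iff all its inputs equal `⊥`. -/
def IsTallyFunction {N : ℕ} {M S : Set Str} (F : (Fin N → Option M) → Option S) : Prop :=
  ∀ m, F m = none ↔ ∀ j, m j = none

/-- The result of the election for arbitrary strings, those outside of `M` being counted as `⊥`. -/
def tally {N : ℕ} {M S : Set Str} (F : (Fin N → Option M) → Option S)
    (v : Fin N → Option Str) : Option Str :=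
  (F fun j => clean M (v j)).map Subtype.val

/-- An e-voting scheme for `N` voters with public keys in `PK`, secret keys in `SK`, ballots in
`Blt` and proofs of tally correctness in `Prf`. Acceptance, written `OK`, is `true`. -/
structure EVote (N : ℕ) (PK SK Blt Prf : Type) where
  setup : ℕ → PMF (PK × SK)
  cast : ℕ → PK → Fin N → Option Str → PMF Blt
  verifyBallot : ℕ → PK → Fin N → Blt → Bool
  evalTally : ℕ → PK → SK → (Fin N → Option Blt) → PMF (Option Str × Option Prf)
  verifyTally : ℕ → PK → (Fin N → Option Blt) → Option Str → Option Prf → Bool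

/-- The challenge of the adversary: the set `S` of the indices of the possibly dishonest ballots
(as an indicator function), and the two tuples `m_{0,j}`, `m_{1,j}`. The entries with `j ∉ S` are
votes, those with `j ∈ S` are ballots. -/
abbrev Query (N : ℕ) (Blt : Type) : Type :=
  (Fin N → Bool) × (Bool → Fin N → Option Str) × (Bool → Fin N → Option Blt)

namespace EVote

variable {N : ℕ} {PK SK Blt Prf : Type}

/-- A stateful adversary against privacy; `σ` is the type of its states. -/
structure Adversary (N : ℕ) (PK Blt Prf σ : Type) where
  query : ℕ → PK → PMF (Query N Blt × σ)
  guess : ℕ → σ × (Fin N → Option Blt) × Option Str × Option Prf → PMF Bool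

structure Adversary.IsPPT {σ : Type} [Coded PK] [Coded Blt] [Coded Prf] [Coded σ]
    (A : Adversary N PK Blt Prf σ) : Prop where
  query : PPT A.query
  guess : PPT A.guess

/-- The winning conditions on the challenge `(S, m, B)`: dishonest ballots are the same in both
tuples; the other entries are votes in `M ∪ {⊥}`; and the tally function has the same value on both
tuples, whichever elements `d` of `M ∪ {⊥}` replace the dishonest ballots. -/
def ValidQuery {M R : Set Str} (F : (Fin N → Option M) → Option R) (q : Query N Blt) : Prop :=
  (∀ j, q.1 j = true → q.2.2 false j = q.2.2 true j) ∧
  (∀ j, q.1 j = false → ∀ b, q.2.1 b j ∈ votes M) ∧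
  ∀ d : Fin N → Option M,
    (F fun j => if q.1 j = true then d j else clean M (q.2.1 false j)) =
      F fun j => if q.1 j = true then d j else clean M (q.2.1 true j)

/-- The ballots of the challenge phase: for `j ∈ S` the submitted ballot, replaced by `⊥` if it is
not accepted; for `j ∉ S` a ballot that casts the vote `m_{b,j}`. -/
def challengeBallots (V : EVote N PK SK Blt Prf) (κ : ℕ) (pk : PK) (q : Query N Blt) (b : Bool) :
    PMF (Fin N → Option Blt) :=
  sampleAll fun j =>
    if q.1 j = true then PMF.pure ((q.2.2 b j).filter fun B => V.verifyBallot κ pk j B)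
    else (V.cast κ pk j (q.2.1 b j)).map some

open Classical in
/-- The privacy game; it outputs `1` iff the adversary wins. -/
def privGame {M R : Set Str} (F : (Fin N → Option M) → Option R) (V : EVote N PK SK Blt Prf)
    {σ : Type} (A : Adversary N PK Blt Prf σ) (κ : ℕ) : PMF Bool := do
  let k ← V.setup κ
  let b ← PMF.uniformOfFintype Bool
  let x ← A.query κ k.1
  let B ← V.challengeBallots κ k.1 x.1 b
  let t ← V.evalTally κ k.1 k.2 B
  let b' ← A.guess κ (x.2, B, t.1, t.2)
  pure (decide (b' = b ∧ ValidQuery F x.1))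

/-- The challenges of the adversary always fulfil the winning conditions. -/
def AlwaysValid {M R : Set Str} (F : (Fin N → Option M) → Option R) (V : EVote N PK SK Blt Prf)
    {σ : Type} (A : Adversary N PK Blt Prf σ) : Prop :=
  ∀ κ, ∀ k ∈ (V.setup κ).support, ∀ x ∈ (A.query κ k.1).support, ValidQuery F x.1

/-- `IND`-security: no PPT adversary wins the privacy game with probability more than negligibly
above `1/2`, and the winning probability of a PPT adversary whose challenges are always valid is
negligibly close to `1/2`. -/
def INDSecure [Coded PK] [Coded Blt] [Coded Prf] {M R : Set Str}
    (F : (Fin N → Option M) → Option R) (V : EVote N PK SK Blt Prf) : Prop :=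
  ∀ (σ : Type) [Coded σ] (A : Adversary N PK Blt Prf σ), A.IsPPT →
    (∃ ν : ℕ → ℝ, Negligible ν ∧ ∀ κ, Pr (privGame F V A κ) - 1 / 2 ≤ ν κ) ∧
    (AlwaysValid F V A → Negligible fun κ => |Pr (privGame F V A κ) - 1 / 2|)

end EVote

/-! ### The fully verifiable scheme -/

namespace Full

/-- A public key: three public keys of the encryption scheme and a commitment. -/
abbrev PubKey : Type := (Fin 3 → Str) × Str

/-- A secret key: the first two secret keys of the encryption scheme, the randomness that was used
to generate them, and the randomness of the commitment. -/
abbrev SecKey : Type := (Fin 2 → Str) × (Fin 2 → Str) × Str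

/-- A ballot: three ciphertexts and a proof. -/
abbrev Ballot : Type := (Fin 3 → Str) × Str

/-- Statements `(j, (Ct₁, Ct₂, Ct₃), (Pk₁, Pk₂, Pk₃), Z)`. -/
abbrev EncStatement (N : ℕ) : Type := Fin N × (Fin 3 → Str) × (Fin 3 → Str) × Str

/-- Witnesses `(m, (r₁, r₂, r₃), u)`. -/
abbrev EncWitness : Type := Option Str × (Fin 3 → Str) × Str

/-- Statements `((Blt₁, …, Blt_N), (Pk₁, Pk₂, Pk₃), y)`. -/
abbrev DecStatement (N : ℕ) : Type := (Fin N → Option Ballot) × (Fin 3 → Str) × Option Str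

/-- Witnesses `((Sk₁', Sk₂'), (s₁, s₂), (i₁, i₂))`. -/
abbrev DecWitness : Type := (Fin 2 → Str) × (Fin 2 → Str) × (Fin 2 → Fin 3)

variable {N : ℕ} {M S : Set Str}

/-- The relation for ballots: all three ciphertexts encrypt the same element of `M ∪ {⊥}`, or `Z`
is a commitment to `0`. -/
def encRel (M : Set Str) (E : PKE) (com : ℕ → Str → Str → Str) (κ : ℕ) (x : EncStatement N)
    (w : EncWitness) : Prop :=
  (w.1 ∈ votes M ∧ ∀ l, (w.2.1 l).length = κ ∧
    x.2.1 l = E.encrypt κ (x.2.2.1 l) w.1 (w.2.1 l)) ∨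
  (w.2.2.length = κ ∧ x.2.2.2 = com κ [false] w.2.2)

/-- The tally that results from the decryption of the `i`-th ciphertexts with the key `sk`. -/
def tallyAt (F : (Fin N → Option M) → Option S) (E : PKE) (κ : ℕ) (i : Fin 3) (sk : Str)
    (B : Fin N → Option Ballot) : Option Str :=
  tally F fun j => (B j).bind fun b => E.decrypt κ sk (b.1 i)

/-- The relation for the tally: two of the three key pairs, with indices `i₁ < i₂`, were honestly
generated, and `y` is `⊥` or the tally obtained by decryption with either of the two keys. -/
def decRel (F : (Fin N → Option M) → Option S) (E : PKE) (κ : ℕ) (x : DecStatement N)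
    (w : DecWitness) : Prop :=
  w.2.2 0 < w.2.2 1 ∧
  (∀ l, (w.2.1 l).length = κ ∧ E.setup κ (w.2.1 l) = (x.2.1 (w.2.2 l), w.1 l)) ∧
  (x.2.2 = none ∨ ∀ l, x.2.2 = tallyAt F E κ (w.2.2 l) (w.1 l) x.1)

/-- Verification of the proof in a ballot. -/
def verifyBallot (enc : ProofSystem (EncStatement N) EncWitness) (κ : ℕ) (pk : PubKey) (j : Fin N)
    (b : Ballot) : Bool :=
  enc.verify κ (j, b.1, pk.1, pk.2) b.2

/-- Replaces the ballots that are not accepted by `⊥`. -/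
def filterBallots (enc : ProofSystem (EncStatement N) EncWitness) (κ : ℕ) (pk : PubKey)
    (B : Fin N → Option Ballot) : Fin N → Option Ballot :=
  fun j => (B j).filter fun b => verifyBallot enc κ pk j b

/-- Generation of the keys. -/
def setup (E : PKE) (com : ℕ → Str → Str → Str) (κ : ℕ) : PMF (PubKey × SecKey) := do
  let r ← coins κ
  let s ← sampleAll fun _ : Fin 3 => coins κ
  pure ((fun l => (E.setup κ (s l)).1, com κ [true] r),
    (fun l => (E.setup κ (s l.castSucc)).2, fun l => s l.castSucc, r))

/-- Casting a ballot. The component `u` of the witness is not used and is set to the empty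
string. -/
def cast (E : PKE) (enc : ProofSystem (EncStatement N) EncWitness) (κ : ℕ) (pk : PubKey)
    (j : Fin N) (v : Option Str) : PMF Ballot := do
  let r ← sampleAll fun _ : Fin 3 => coins κ
  let Ct : Fin 3 → Str := fun l => E.encrypt κ (pk.1 l) v (r l)
  let π ← enc.prove κ (j, Ct, pk.1, pk.2) (v, r, [])
  pure (Ct, π)

open Classical in
/-- Evaluation of the tally. The tally is `⊥` if the tallies for the first two keys differ. -/
def evalTally (F : (Fin N → Option M) → Option S) (E : PKE)
    (enc : ProofSystem (EncStatement N) EncWitness) (dec : ProofSystem (DecStatement N) DecWitness)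
    (κ : ℕ) (pk : PubKey) (sk : SecKey) (B₀ : Fin N → Option Ballot) :
    PMF (Option Str × Option Str) :=
  let B := filterBallots enc κ pk B₀
  if ∀ j, B j = none then PMF.pure (none, none) else
    let y₁ := tallyAt F E κ 0 (sk.1 0) B
    let y₂ := tallyAt F E κ 1 (sk.1 1) B
    let y := if y₁ = y₂ then y₁ else none
    (dec.prove κ (B, pk.1, y) (sk.1, sk.2.1, ![0, 1])).map fun γ => (y, some γ)

open Classical in
/-- Verification of the tally. -/
def verifyTally (enc : ProofSystem (EncStatement N) EncWitness)
    (dec : ProofSystem (DecStatement N) DecWitness) (κ : ℕ) (pk : PubKey)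
    (B₀ : Fin N → Option Ballot) (y : Option Str) (γ : Option Str) : Bool :=
  let B := filterBallots enc κ pk B₀
  if y = none then decide (∀ j, B j = none)
  else γ.elim false fun g => dec.verify κ (B, pk.1, y) g

end Full

/-- The fully verifiable e-voting scheme. -/
def evoteFull {N : ℕ} {M S : Set Str} (F : (Fin N → Option M) → Option S) (E : PKE)
    (com : ℕ → Str → Str → Str)
    (enc : ProofSystem (Full.EncStatement N) Full.EncWitness)
    (dec : ProofSystem (Full.DecStatement N) Full.DecWitness) :
    EVote N Full.PubKey Full.SecKey Full.Ballot Str where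
  setup := Full.setup E com
  cast := Full.cast E enc
  verifyBallot := Full.verifyBallot enc
  evalTally := Full.evalTally F E enc dec
  verifyTally := Full.verifyTally enc dec

end EVoting

end

noncomputable section

namespace EVoting

section

/-! ### Circuits -/

section Circuits

variable {X Y : Type} {inp : Set (X → Bool)}

/-! The proof is a hybrid argument between the experiments with `b = 0` and `b = 1`. Validity of a
query quantifies over all replacements of the dishonest votes, so no reduction can test it. It is
replaced by `gate`, which checks only the instance given by the decrypted votes of the adversary's
ballots. The experiment `hyb` stops with output `0` if the gate fails, and otherwise computes the
result from the plain votes of the query and the decrypted dishonest votes. With a commitment to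
`1`, perfect soundness and binding force every accepted dishonest ballot to contain one vote three
times. Hence a valid query passes the gate, and the game after it agrees with `hyb`
(`gate_of_validQuery`, `realAfterQuery_eq`). An invalid query contributes nothing to winning, so in
all cases the winning probability is at most `1/2` plus half the difference of the two hybrid
experiments, with equality if all queries are valid (`Pr_win_le`, `Pr_win_of_valid`).

It remains to connect the two hybrid experiments (`indist_hyb`). The commitment is switched to `0`
by hiding, and the honest ballots are then proved with its opening by witness indistinguishability,
one ballot at a time. From then on the three ciphertexts of an honest ballot may disagree. The tally
uses two of the three keys; the ciphertexts under the third key can be changed from `m_0` to `m_1`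
by IND-CPA (`indist_hyb_votes`), after which the pair of keys is exchanged by witness
indistinguishability of the tally proof (`indist_hyb_keys`). Three rounds change all ciphertexts.

Exchanging keys requires that the dishonest ballots decrypt consistently, which soundness no longer
gives for a commitment to `0`. But an inconsistency can be detected efficiently with the secret keys
and is impossible for a commitment to `1`, so by hiding its probability is negligible
(`negligible_bad`).

The reductions must be shown to be efficient in the circuit model; hence the closure properties of
`PPT` and `PolyTime`. -/

theorem IsCircuit.append {L₁ L₂ : List (X → Bool)} (h₁ : IsCircuit inp L₁)
    (h₂ : IsCircuit inp L₂) : IsCircuit inp (L₁ ++ L₂) := by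
  induction h₁ with
  | nil => exact h₂
  | input hg _ ih => exact .input hg ih
  | const b _ ih => exact .const b ih
  | nand hg hh _ ih =>
    exact .nand (List.mem_append_left _ hg) (List.mem_append_left _ hh) ih

/-- Some circuit with at most `k` gates computes all the functions in `T`. -/
def Computes (inp : Set (X → Bool)) (k : ℕ) (T : Set (X → Bool)) : Prop :=
  ∃ L, IsCircuit inp L ∧ L.length ≤ k ∧ ∀ f ∈ T, f ∈ L

theorem Computes.mono {k k' : ℕ} {T T' : Set (X → Bool)} (h : Computes inp k T) (hk : k ≤ k')
    (hT : T' ⊆ T) : Computes inp k' T' := by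
  obtain ⟨L, h1, h2, h3⟩ := h
  exact ⟨L, h1, h2.trans hk, fun f hf => h3 f (hT hf)⟩

theorem Computes.union {k₁ k₂ : ℕ} {T₁ T₂ : Set (X → Bool)} (h₁ : Computes inp k₁ T₁)
    (h₂ : Computes inp k₂ T₂) : Computes inp (k₁ + k₂) (T₁ ∪ T₂) := by
  obtain ⟨L, h1, h2, h3⟩ := h₁
  obtain ⟨L', h1', h2', h3'⟩ := h₂
  refine ⟨L ++ L', h1.append h1', by simp; omega, ?_⟩
  rintro f (hf | hf)
  · exact List.mem_append_left _ (h3 f hf)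
  · exact List.mem_append_right _ (h3' f hf)

theorem Computes.input {f : X → Bool} (hf : f ∈ inp) : Computes inp 1 {f} :=
  ⟨[f], .input hf .nil, le_rfl, by simp⟩

theorem Computes.const (b : Bool) : Computes inp 1 {fun _ => b} :=
  ⟨[fun _ => b], .const b .nil, le_rfl, by simp⟩

theorem Computes.nand {k : ℕ} {T : Set (X → Bool)} {f g : X → Bool} (h : Computes inp k T)
    (hf : f ∈ T) (hg : g ∈ T) :
    Computes inp (k + 1) (insert (fun x => !(f x && g x)) T) := by
  obtain ⟨L, h1, h2, h3⟩ := h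
  refine ⟨_ :: L, .nand (h3 f hf) (h3 g hg) h1, by simpa using h2, ?_⟩
  rintro e (rfl | he)
  · exact List.mem_cons_self
  · exact List.mem_cons_of_mem _ (h3 e he)

/-- Selection between two functions by a third one. -/
theorem Computes.mux {k₁ k₂ k₃ : ℕ} {s f g : X → Bool} (hs : Computes inp k₁ {s})
    (hf : Computes inp k₂ {f}) (hg : Computes inp k₃ {g}) :
    Computes inp (k₁ + k₂ + k₃ + 4) {fun x => if s x then f x else g x} := by
  have h0 := (hs.union hf).union hg
  -- The four extra gates: the negation of `s`, `NAND` of `s` and `f`, `NAND` of the negation and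
  -- `g`, and the `NAND` of the last two.
  have h1 := h0.nand (f := s) (g := s) (by simp) (by simp)
  have h2 := h1.nand (f := s) (g := f) (by simp) (by simp)
  have h3 := h2.nand (f := fun x => !(s x && s x)) (g := g) (by simp) (by simp)
  have h4 := h3.nand (f := fun x => !(s x && f x))
    (g := fun x => !((!(s x && s x)) && g x)) (by simp) (by simp)
  refine h4.mono le_rfl ?_
  rw [Set.singleton_subset_iff]
  convert Set.mem_insert _ _ using 1
  funext x
  cases s x <;> simp

theorem Computes.range_lt {k : ℕ} {f : ℕ → X → Bool} (m : ℕ)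
    (h : ∀ i < m, Computes inp k {f i}) : Computes inp (m * k) {g | ∃ i < m, g = f i} := by
  induction m with
  | zero => exact ⟨[], .nil, by simp, by simp⟩
  | succ m ih =>
    refine ((ih fun i hi => h i (by omega)).union (h m (by omega))).mono (by ring_nf; omega) ?_
    rintro g ⟨i, hi, rfl⟩
    rcases Nat.lt_succ_iff_lt_or_eq.1 hi with h | rfl
    · exact Or.inl ⟨i, h, rfl⟩
    · exact Or.inr rfl

theorem Computes.and_lt {k : ℕ} {f : ℕ → X → Bool} (m : ℕ)
    (h : ∀ i < m, Computes inp k {f i}) :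
    Computes inp (m * (k + 5) + 1) {fun x => decide (∀ i < m, f i x = true)} := by
  induction m with
  | zero => exact (Computes.const true).mono (by omega) (by simp)
  | succ m ih =>
    -- Each conjunct costs `k` gates, the constant `false`, and the four gates of `mux`: this is the
    -- `k + 5`.
    refine (((h m (by omega)).mux (ih fun i hi => h i (by omega)) (.const false))).mono
      (by ring_nf; omega) ?_
    rw [Set.singleton_subset_iff, Set.mem_singleton_iff]
    funext x
    by_cases hm : f m x = true
    · simp only [hm, if_true, Nat.lt_succ_iff_lt_or_eq, or_imp, forall_and,
        forall_eq, and_true]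
    · simp only [hm, Bool.false_eq_true, if_false, decide_eq_false_iff_not]
      exact fun H => hm (H m (by omega))

/-- Composition of circuits. -/
theorem Computes.comp {inp' : Set (Y → Bool)} {k k' : ℕ} {T : Set (X → Bool)}
    {T' : Set (Y → Bool)} {φ : X → Y} (h : Computes inp k T) (h' : Computes inp' k' T')
    (hφ : ∀ f ∈ inp', f ∘ φ ∈ T ∪ inp) :
    Computes inp (k + k') (T ∪ (fun f => f ∘ φ) '' T') := by
  obtain ⟨L, h1, h2, h3⟩ := h
  obtain ⟨L', h1', h2', h3'⟩ := h'
  -- The second circuit is rebuilt gate by gate on top of the first; an input gate that reads an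
  -- output of the first circuit adds no gate.
  suffices H : ∃ L'', IsCircuit inp L'' ∧ L''.length ≤ L.length + L'.length ∧
      (∀ f ∈ L, f ∈ L'') ∧ ∀ f ∈ L', f ∘ φ ∈ L'' by
    obtain ⟨L'', g1, g2, g3, g4⟩ := H
    refine ⟨L'', g1, by omega, ?_⟩
    rintro _ (hf | ⟨f, hf, rfl⟩)
    · exact g3 _ (h3 _ hf)
    · exact g4 _ (h3' _ hf)
  clear h2' h3'
  induction h1' with
  | nil => exact ⟨L, h1, by simp, fun _ h => h, by simp⟩
  | @input M g hg _ ih =>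
    obtain ⟨L'', g1, g2, g3, g4⟩ := ih
    rcases hφ g hg with hT | hi
    · refine ⟨L'', g1, by simp; omega, g3, ?_⟩
      rintro f hf
      rcases List.mem_cons.1 hf with rfl | hf
      · exact g3 _ (h3 _ hT)
      · exact g4 f hf
    · refine ⟨g ∘ φ :: L'', .input hi g1, by simp; omega,
        fun f hf => List.mem_cons_of_mem _ (g3 f hf), ?_⟩
      rintro f hf
      rcases List.mem_cons.1 hf with rfl | hf
      · exact List.mem_cons_self
      · exact List.mem_cons_of_mem _ (g4 f hf)
  | @const M b _ ih =>
    obtain ⟨L'', g1, g2, g3, g4⟩ := ih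
    refine ⟨(fun _ => b) :: L'', .const b g1, by simp; omega,
        fun f hf => List.mem_cons_of_mem _ (g3 f hf), ?_⟩
    rintro f hf
    rcases List.mem_cons.1 hf with rfl | hf
    · exact List.mem_cons_self
    · exact List.mem_cons_of_mem _ (g4 f hf)
  | @nand M g e hg he _ ih =>
    obtain ⟨L'', g1, g2, g3, g4⟩ := ih
    refine ⟨_ :: L'', .nand (g4 g hg) (g4 e he) g1, by simp; omega,
        fun f hf => List.mem_cons_of_mem _ (g3 f hf), ?_⟩
    rintro f hf
    rcases List.mem_cons.1 hf with rfl | hf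
    · exact List.mem_cons_self
    · exact List.mem_cons_of_mem _ (g4 f hf)

end Circuits

theorem eval_le_eval (p : Polynomial ℕ) {a b : ℕ} (h : a ≤ b) : p.eval a ≤ p.eval b := by
  induction p using Polynomial.induction_on' with
  | add p q hp hq => simpa using add_le_add hp hq
  | monomial n c => simpa using Nat.mul_le_mul_left c (Nat.pow_le_pow_left h n)

/-! ### Closure properties of probabilistic polynomial time -/

/-- The input wires of circuits for data of size at most `n` and `c` random bits. -/
abbrev wires (α : Type) [Coded α] (n c : ℕ) :
    Set ({a : α // Coded.size a ≤ n} × (Fin c → Bool) → Bool) :=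
  Set.range (fun (i : ℕ) x => Coded.bit x.1.1 i) ∪ Set.range (fun (i : Fin c) x => x.2 i)

variable {α β γ : Type} [Coded α] [Coded β] [Coded γ]

/-- The form in which circuits can be combined through `Computes`, without naming lists of gates. -/
theorem ppt_iff {f : ℕ → α → PMF β} : PPT f ↔ ∃ p : Polynomial ℕ, ∀ κ n : ℕ,
    ∃ (c : ℕ) (g : {a : α // Coded.size a ≤ n} → (Fin c → Bool) → β) (k : ℕ),
      Computes (wires α n c) k (Set.range fun (i : ℕ) x => Coded.bit (g x.1 x.2) i) ∧
      c + k ≤ p.eval (κ + n) ∧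
      (∀ a r, Coded.size (g a r) ≤ p.eval (κ + n)) ∧
      ∀ a, (PMF.uniformOfFintype (Fin c → Bool)).map (g a) = f κ a.1 := by
  constructor
  · rintro ⟨p, hp⟩
    refine ⟨p, fun κ n => ?_⟩
    obtain ⟨c, g, L, h1, h2, h3, h4, h5⟩ := hp κ n
    exact ⟨c, g, L.length, ⟨L, h1, le_rfl, by rintro _ ⟨i, rfl⟩; exact h3 i⟩, h2, h4, h5⟩
  · rintro ⟨p, hp⟩
    refine ⟨p, fun κ n => ?_⟩
    obtain ⟨c, g, k, ⟨L, h1, h2, h3⟩, h4, h5, h6⟩ := hp κ n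
    exact ⟨c, g, L, h1, by omega, fun i => h3 _ ⟨i, rfl⟩, h5, h6⟩

theorem uniform_append (c d : ℕ) :
    (PMF.uniformOfFintype (Fin (c + d) → Bool)).map
      (fun r => ((fun i => r (Fin.castAdd d i), fun i => r (Fin.natAdd c i)) :
        (Fin c → Bool) × (Fin d → Bool))) =
    (PMF.uniformOfFintype (Fin c → Bool)).bind fun r =>
      (PMF.uniformOfFintype (Fin d → Bool)).map fun r' => (r, r') := by
  classical
  ext ⟨r, r'⟩
  -- The only preimage of `(r, r')` is the concatenation, and the masses agree because `2 ^ (c + d)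
  -- = 2 ^ c * 2 ^ d`.
  rw [PMF.map_apply, PMF.bind_apply, tsum_eq_single (Fin.append r r'), tsum_eq_single r,
    PMF.map_apply, tsum_eq_single r']
  · simp [pow_add, ENNReal.mul_inv]
  · intro b hb; simp [Ne.symm hb]
  · intro b hb
    simp only [mul_eq_zero]
    right
    rw [PMF.map_apply, ENNReal.tsum_eq_zero]
    intro i; simp [Ne.symm hb]
  · intro b hb
    rw [if_neg]
    rintro h
    apply hb
    simp only [Prod.mk.injEq] at h
    rw [h.1, h.2]
    exact (Fin.append_castAdd_natAdd (f := b)).symm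

/-- Sequential composition; the second algorithm also sees the input of the first one. -/
theorem PPT.bind {f : ℕ → α → PMF β} {h : ℕ → α → β → PMF γ} (hf : PPT f)
    (hh : PPT fun κ (x : α × β) => h κ x.1 x.2) : PPT fun κ a => (f κ a).bind (h κ a) := by
  rw [ppt_iff] at hf hh ⊢
  obtain ⟨p, hp⟩ := hf
  obtain ⟨q, hq⟩ := hh
  -- The input of the second algorithm is a pair of components of sizes at most `n` and `p (κ + n)`,
  -- and pairing doubles the larger size.
  refine ⟨p + q.comp (2 * (Polynomial.X + p)), fun κ n => ?_⟩
  obtain ⟨c, g, k, h1, h2, h3, h4⟩ := hp κ n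
  set m := p.eval (κ + n) with hm
  obtain ⟨d, e, l, h1', h2', h3', h4'⟩ := hq κ (2 * (n + m))
  have hle : q.eval (κ + 2 * (n + m)) ≤ (q.comp (2 * (Polynomial.X + p))).eval (κ + n) := by
    rw [Polynomial.eval_comp]
    refine eval_le_eval q ?_
    simp only [Polynomial.eval_mul, Polynomial.eval_add, Polynomial.eval_X,
      Polynomial.eval_ofNat]
    omega
  let φ : {a : α // Coded.size a ≤ n} × (Fin (c + d) → Bool) →
      {x : α × β // Coded.size x ≤ 2 * (n + m)} × (Fin d → Bool) := fun x =>
    (⟨(x.1.1, g x.1 fun i => x.2 (Fin.castAdd d i)), by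
      exact Nat.mul_le_mul_left 2 (max_le (x.1.2.trans (Nat.le_add_right _ _))
        ((h3 _ _).trans (Nat.le_add_left _ _)))⟩, fun i => x.2 (Fin.natAdd c i))
  let ψ : {a : α // Coded.size a ≤ n} × (Fin (c + d) → Bool) →
      {a : α // Coded.size a ≤ n} × (Fin c → Bool) := fun x =>
    (x.1, fun i => x.2 (Fin.castAdd d i))
  -- Composition with the empty circuit only renames wires: the first algorithm reads the first `c`
  -- coins.
  have hψ := Computes.comp (φ := ψ) (inp := wires α n (c + d)) (k := 0) (T := ∅)
    ⟨[], .nil, by simp, by simp⟩ h1 (by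
      rintro _ (⟨i, rfl⟩ | ⟨i, rfl⟩)
      · exact Or.inr (Or.inl ⟨i, rfl⟩)
      · exact Or.inr (Or.inr ⟨Fin.castAdd d i, rfl⟩))
  have hφ := Computes.comp (φ := φ) hψ h1' (by
      rintro _ (⟨i, rfl⟩ | ⟨i, rfl⟩)
      -- Even bits of the pair are bits of the original input; odd bits are outputs of the first
      -- circuit.
      · rcases Nat.mod_two_eq_zero_or_one i with hi | hi
        · refine Or.inr (Or.inl ⟨i / 2, ?_⟩)
          funext x
          change _ = if i % 2 = 0 then _ else _
          rw [if_pos hi]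
        · refine Or.inl (Or.inr ⟨_, ⟨i / 2, rfl⟩, ?_⟩)
          funext x
          change _ = if i % 2 = 0 then _ else _
          rw [if_neg (by omega)]
          rfl
      · exact Or.inr (Or.inr ⟨Fin.natAdd c i, rfl⟩))
  refine ⟨c + d, fun a r => e (φ (a, r)).1 (φ (a, r)).2, _, hφ.mono le_rfl ?_, ?_, ?_, ?_⟩
  · rintro _ ⟨i, rfl⟩
    exact Or.inr ⟨_, ⟨i, rfl⟩, rfl⟩
  · rw [Polynomial.eval_add]
    omega
  · intro a r
    rw [Polynomial.eval_add]
    exact (h3' _ _).trans (hle.trans (Nat.le_add_left _ _))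
  · intro a
    have hs : ∀ r, Coded.size (a.1, g a r) ≤ 2 * (n + m) := fun r => by
      exact Nat.mul_le_mul_left 2 (max_le (a.2.trans (Nat.le_add_right _ _))
        ((h3 _ _).trans (Nat.le_add_left _ _)))
    have key := congrArg (PMF.map fun rr : (Fin c → Bool) × (Fin d → Bool) =>
      e ⟨(a.1, g a rr.1), hs rr.1⟩ rr.2) (uniform_append c d)
    rw [PMF.map_comp, PMF.map_bind] at key
    refine key.trans ?_
    rw [← h4 a, PMF.bind_map]
    congr 1
    funext r
    rw [PMF.map_comp]
    exact h4' ⟨(a.1, g a r), hs r⟩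

theorem PPT.size_le {f : ℕ → α → PMF β} (hf : PPT f) : ∃ p : Polynomial ℕ, ∀ κ a,
    ∀ b ∈ (f κ a).support, Coded.size b ≤ p.eval (κ + Coded.size a) := by
  obtain ⟨p, hp⟩ := hf
  refine ⟨p, fun κ a b hb => ?_⟩
  obtain ⟨c, g, L, -, -, -, h4, h5⟩ := hp κ (Coded.size a)
  rw [← h5 ⟨a, le_rfl⟩, PMF.support_map] at hb
  obtain ⟨r, -, rfl⟩ := hb
  exact h4 _ _

theorem PolyTime.size_le {f : ℕ → α → β} (hf : PolyTime f) : ∃ p : Polynomial ℕ, ∀ κ a,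
    Coded.size (f κ a) ≤ p.eval (κ + Coded.size a) := by
  obtain ⟨p, hp⟩ := PPT.size_le hf
  exact ⟨p, fun κ a => hp κ a _ (by simp)⟩

theorem PPT.of_eq {f g : ℕ → α → PMF β} (hf : PPT f) (h : ∀ κ a, f κ a = g κ a) : PPT g := by
  have : f = g := funext fun κ => funext (h κ)
  rwa [← this]

theorem PolyTime.of_eq {f g : ℕ → α → β} (hf : PolyTime f) (h : ∀ κ a, f κ a = g κ a) :
    PolyTime g := by
  have : f = g := funext fun κ => funext (h κ)
  rwa [← this]

/-- The input wires of deterministic circuits. -/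
abbrev inputs (α : Type) [Coded α] (n : ℕ) : Set ({a : α // Coded.size a ≤ n} → Bool) :=
  Set.range fun (i : ℕ) x => Coded.bit x.1 i

/-- Only the bits below the size bound need a circuit of their own; a single constant gate serves
all the padding bits. -/
theorem PolyTime.of_bits {f : ℕ → α → β} (p q : Polynomial ℕ)
    (hs : ∀ κ a, Coded.size (f κ a) ≤ p.eval (κ + Coded.size a))
    (hb : ∀ κ n i, Computes (inputs α n) (q.eval (κ + n))
      {fun a => Coded.bit (f κ a.1) i}) : PolyTime f := by
  unfold PolyTime
  rw [ppt_iff]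
  refine ⟨p * q + 1 + p, fun κ n => ?_⟩
  have hs' : ∀ a : {a : α // Coded.size a ≤ n}, Coded.size (f κ a.1) ≤ p.eval (κ + n) :=
    fun a => (hs κ a.1).trans (eval_le_eval p (by have := a.2; omega))
  have h := (Computes.range_lt (p.eval (κ + n)) fun i _ => hb κ n i).union (.const false)
  have h' := Computes.comp (φ := fun x : {a : α // Coded.size a ≤ n} × (Fin 0 → Bool) => x.1)
    (inp := wires α n 0) (k := 0) (T := ∅)
    ⟨[], .nil, by simp, by simp⟩ h (by rintro _ ⟨i, rfl⟩; exact Or.inr (Or.inl ⟨i, rfl⟩))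
  refine ⟨0, fun a _ => f κ a.1, _, h'.mono le_rfl ?_, ?_, ?_, ?_⟩
  · rintro _ ⟨i, rfl⟩
    right
    by_cases hi : i < p.eval (κ + n)
    · exact ⟨_, Or.inl ⟨i, hi, rfl⟩, rfl⟩
    · refine ⟨_, Or.inr rfl, ?_⟩
      funext x
      exact (Coded.bit_eq_false _ _ ((hs' x.1).trans (by omega))).symm
  · simp only [Polynomial.eval_add, Polynomial.eval_mul, Polynomial.eval_one]
    omega
  · intro a _
    refine (hs' a).trans ?_
    rw [Polynomial.eval_add]
    omega
  · intro a
    exact PMF.map_const _ _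

/-- Functions whose output bits are input bits or constants. -/
theorem PolyTime.of_wiring {f : ℕ → α → β} (p : Polynomial ℕ)
    (hs : ∀ κ a, Coded.size (f κ a) ≤ p.eval (κ + Coded.size a))
    (hb : ∀ κ i, (∃ j, ∀ a, Coded.bit (f κ a) i = Coded.bit a j) ∨
      ∃ b, ∀ a, Coded.bit (f κ a) i = b) : PolyTime f := by
  refine PolyTime.of_bits p 1 hs fun κ n i => ?_
  rw [Polynomial.eval_one]
  rcases hb κ i with ⟨j, hj⟩ | ⟨b, hb⟩
  · simp only [hj]
    exact .input ⟨j, rfl⟩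
  · simp only [hb]
    exact .const b

/-- Constants may depend on the security parameter. -/
theorem PolyTime.const' {v : ℕ → β} (p : Polynomial ℕ) (h : ∀ κ, Coded.size (v κ) ≤ p.eval κ) :
    PolyTime fun κ (_ : α) => v κ :=
  .of_wiring p (fun κ a => (h κ).trans (eval_le_eval p (by omega)))
    fun κ i => Or.inr ⟨_, fun _ => rfl⟩

theorem PolyTime.const (v : β) : PolyTime fun _ (_ : α) => v :=
  .const' (Polynomial.C (Coded.size v)) fun κ => by simp

theorem PPT.const (v : β) : PPT fun _ (_ : α) => PMF.pure v := PolyTime.const v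

/-- Proved on circuits directly, because `PPT.comp` is deduced from it and `PPT.bind`: the second
stage there also receives the original input, which has to be ignored. -/
theorem PPT.comp_snd {h : ℕ → β → PMF γ} (hh : PPT h) :
    PPT fun κ (x : α × β) => h κ x.2 := by
  rw [ppt_iff] at hh ⊢
  obtain ⟨p, hp⟩ := hh
  refine ⟨p, fun κ n => ?_⟩
  obtain ⟨c, g, k, h1, h2, h3, h4⟩ := hp κ n
  have hs : ∀ x : {x : α × β // Coded.size x ≤ n}, Coded.size x.1.2 ≤ n := fun x =>
    (le_trans (le_max_right _ _) (Nat.le_mul_of_pos_left _ (by omega))).trans x.2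
  have h := Computes.comp (inp := wires (α × β) n c) (k := 0) (T := ∅)
    (φ := fun x => (⟨x.1.1.2, hs x.1⟩, x.2)) ⟨[], .nil, by simp, by simp⟩ h1 (by
      rintro _ (⟨i, rfl⟩ | ⟨i, rfl⟩)
      · refine Or.inr (Or.inl ⟨2 * i + 1, ?_⟩)
        funext x
        change (if (2 * i + 1) % 2 = 0 then _ else _) = _
        rw [if_neg (by omega)]
        congr 1
        omega
      · exact Or.inr (Or.inr ⟨i, rfl⟩))
  refine ⟨c, fun x r => g ⟨x.1.2, hs x⟩ r, _, h.mono le_rfl ?_, by omega, fun x r => h3 _ r,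
    fun x => h4 ⟨x.1.2, hs x⟩⟩
  rintro _ ⟨i, rfl⟩
  exact Or.inr ⟨_, ⟨i, rfl⟩, rfl⟩

theorem PPT.comp {f : ℕ → α → β} {h : ℕ → β → PMF γ} (hh : PPT h) (hf : PolyTime f) :
    PPT fun κ a => h κ (f κ a) :=
  (PPT.bind hf (h := fun κ _ b => h κ b) hh.comp_snd).of_eq fun _ _ => PMF.pure_bind _ _

theorem PolyTime.comp {f : ℕ → α → β} {h : ℕ → β → γ} (hh : PolyTime h) (hf : PolyTime f) :
    PolyTime fun κ a => h κ (f κ a) :=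
  PPT.comp (h := fun κ b => PMF.pure (h κ b)) hh hf

theorem PolyTime.id : PolyTime fun (_ : ℕ) (a : α) => a :=
  .of_wiring Polynomial.X (fun κ a => by rw [Polynomial.eval_X]; omega)
    fun _ i => Or.inl ⟨i, fun _ => rfl⟩

theorem size_fst_le (x : α × β) : Coded.size x.1 ≤ Coded.size x :=
  le_trans (le_max_left _ _) (Nat.le_mul_of_pos_left _ (by omega))

theorem size_snd_le (x : α × β) : Coded.size x.2 ≤ Coded.size x :=
  le_trans (le_max_right _ _) (Nat.le_mul_of_pos_left _ (by omega))

theorem bit_fst (x : α × β) (i : ℕ) : Coded.bit x.1 i = Coded.bit x (2 * i) := by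
  change _ = if (2 * i) % 2 = 0 then _ else _
  rw [if_pos (by omega)]
  congr 1
  omega

theorem bit_snd (x : α × β) (i : ℕ) : Coded.bit x.2 i = Coded.bit x (2 * i + 1) := by
  change _ = if (2 * i + 1) % 2 = 0 then _ else _
  rw [if_neg (by omega)]
  congr 1
  omega

theorem bit_prod (x : α × β) (i : ℕ) : Coded.bit x i =
    if i % 2 = 0 then Coded.bit x.1 (i / 2) else Coded.bit x.2 (i / 2) := rfl

theorem PolyTime.fst {f : ℕ → α → β × γ} (hf : PolyTime f) : PolyTime fun κ a => (f κ a).1 :=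
  PolyTime.comp (h := fun _ (x : β × γ) => x.1) (.of_wiring Polynomial.X
    (fun κ a => by rw [Polynomial.eval_X]; exact (size_fst_le a).trans (Nat.le_add_left _ _))
    fun κ i => Or.inl ⟨2 * i, fun a => bit_fst a i⟩) hf

theorem PolyTime.snd {f : ℕ → α → β × γ} (hf : PolyTime f) : PolyTime fun κ a => (f κ a).2 :=
  PolyTime.comp (h := fun _ (x : β × γ) => x.2) (.of_wiring Polynomial.X
    (fun κ a => by rw [Polynomial.eval_X]; exact (size_snd_le a).trans (Nat.le_add_left _ _))
    fun κ i => Or.inl ⟨2 * i + 1, fun a => bit_snd a i⟩) hf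

theorem PolyTime.pair {f : ℕ → α → β} {g : ℕ → α → γ} (hf : PolyTime f) (hg : PolyTime g) :
    PolyTime fun κ a => (f κ a, g κ a) := by
  -- Two applications of `PPT.bind` leave the data `((a, b), c)`; extracting `(b, c)` is mere
  -- wiring.
  have hw : PolyTime fun (_ : ℕ) (x : (α × β) × γ) => (x.1.2, x.2) := by
    refine .of_wiring (2 * Polynomial.X) (fun κ x => ?_) fun κ i => Or.inl ?_
    · rw [Polynomial.eval_mul, Polynomial.eval_X, Polynomial.eval_ofNat]
      refine Nat.mul_le_mul_left 2 (le_trans (max_le ?_ (size_snd_le x)) (Nat.le_add_left _ _))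
      exact (size_snd_le _).trans (size_fst_le x)
    · rcases Nat.mod_two_eq_zero_or_one i with hi | hi
      · exact ⟨2 * (2 * (i / 2) + 1), fun x => by
          rw [bit_prod, if_pos hi, bit_snd, bit_fst]⟩
      · exact ⟨2 * (i / 2) + 1, fun x => by
          rw [bit_prod, if_neg (by omega), ← bit_snd]⟩
  have hg' : PPT fun κ (x : α × β) => PMF.pure (g κ x.1) := hg.comp PolyTime.id.fst
  refine (PPT.bind hf (h := fun κ a b => (PMF.pure (g κ a)).bind fun c => PMF.pure (b, c))
    (PPT.bind hg' (h := fun _ (x : α × β) c => PMF.pure (x.2, c)) hw)).of_eq ?_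
  intro κ a
  rw [PMF.pure_bind, PMF.pure_bind]

theorem PPT.map {f : ℕ → α → PMF β} {h : ℕ → α → β → γ} (hf : PPT f)
    (hh : PolyTime fun κ (x : α × β) => h κ x.1 x.2) : PPT fun κ a => (f κ a).map (h κ a) :=
  hf.bind (h := fun κ a b => PMF.pure (h κ a b)) hh

theorem PolyTime.bite {c : ℕ → α → Bool} {f g : ℕ → α → β} (hc : PolyTime c) (hf : PolyTime f)
    (hg : PolyTime g) : PolyTime fun κ a => if c κ a then f κ a else g κ a := by
  have hw : PolyTime fun (_ : ℕ) (x : Bool × β × β) => if x.1 then x.2.1 else x.2.2 := by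
    -- Three input gates and the four gates of `mux`.
    refine .of_bits Polynomial.X 7 (fun κ x => ?_) fun κ n i => ?_
    · rw [Polynomial.eval_X]
      have h1 := (size_fst_le x.2).trans (size_snd_le x)
      have h2 := (size_snd_le x.2).trans (size_snd_le x)
      split_ifs <;> omega
    · have h1 : Computes (inputs (Bool × β × β) n) 1 {fun x => Coded.bit x.1 (2 * 0)} :=
        .input ⟨_, rfl⟩
      have h2 : Computes (inputs (Bool × β × β) n) 1
          {fun x => Coded.bit x.1 (2 * (2 * i) + 1)} := .input ⟨_, rfl⟩
      have h3 : Computes (inputs (Bool × β × β) n) 1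
          {fun x => Coded.bit x.1 (2 * (2 * i + 1) + 1)} := .input ⟨_, rfl⟩
      refine (h1.mux h2 h3).mono (by simp) ?_
      rw [Set.singleton_subset_iff, Set.mem_singleton_iff]
      funext x
      rw [← bit_fst, ← bit_snd, ← bit_fst, ← bit_snd, ← bit_snd]
      change _ = if (x.1.1 && decide (0 = 0)) = true then _ else _
      cases x.1.1 <;> simp
  exact hw.comp (hc.pair (hf.pair hg))

/-- Both branches are sampled and one outcome is discarded; this does not change the law of the
other. -/
theorem PPT.bite {c : ℕ → α → Bool} {f g : ℕ → α → PMF β} (hc : PolyTime c) (hf : PPT f)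
    (hg : PPT g) : PPT fun κ a => if c κ a then f κ a else g κ a := by
  refine (hf.bind (h := fun κ a b => (g κ a).map fun b' => if c κ a then b else b') ?_).of_eq ?_
  · refine PPT.map (f := fun κ (x : α × β) => g κ x.1)
      (h := fun κ x b' => if c κ x.1 then x.2 else b') (hg.comp PolyTime.id.fst) ?_
    exact .bite (hc.comp PolyTime.id.fst.fst) PolyTime.id.fst.snd PolyTime.id.snd
  · intro κ a
    cases c κ a
    · exact (PMF.bind_const _ _).trans (PMF.map_id (g κ a))
    · exact (congrArg (f κ a).bind (funext fun b => PMF.map_const (g κ a) b)).trans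
        (PMF.bind_pure _)

/-- Codes are injective and vanish beyond the size, so equality amounts to equality of the first `n`
bits, where `n` bounds the size of the pair. -/
theorem PolyTime.decide_eq {f g : ℕ → α → β} [∀ κ a, Decidable (f κ a = g κ a)]
    (hf : PolyTime f) (hg : PolyTime g) : PolyTime fun κ a => decide (f κ a = g κ a) := by
  classical
  have hw : PolyTime fun (_ : ℕ) (x : β × β) => decide (x.1 = x.2) := by
    refine .of_bits 1 (Polynomial.X * 20 + 1) (fun κ x => by simp [Coded.size])
      fun κ n i => ?_
    -- The output is a `Bool`, whose code can be nonzero only at position `0`.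
    by_cases hi : i = 0
    · subst hi
      have h1 : ∀ j, Computes (inputs (β × β) n) 1 {fun x => Coded.bit x.1 (2 * j)} :=
        fun j => .input ⟨_, rfl⟩
      have h2 : ∀ j, Computes (inputs (β × β) n) 1 {fun x => Coded.bit x.1 (2 * j + 1)} :=
        fun j => .input ⟨_, rfl⟩
      refine (Computes.and_lt n fun j _ => (h1 j).mux (h2 j)
        ((h2 j).mux (.const false) (.const true))).mono ?_ ?_
      · simp only [Polynomial.eval_add, Polynomial.eval_mul, Polynomial.eval_X,
          Polynomial.eval_ofNat, Polynomial.eval_one]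
        nlinarith
      · rw [Set.singleton_subset_iff, Set.mem_singleton_iff]
        funext x
        simp only [← bit_fst, ← bit_snd]
        change (decide (x.1.1 = x.1.2) && decide (0 = 0)) = _
        simp only [decide_true, Bool.and_true, decide_eq_decide]
        have hj : ∀ j, (if Coded.bit x.1.1 j = true then Coded.bit x.1.2 j
            else if Coded.bit x.1.2 j = true then false else true) = true ↔
            Coded.bit x.1.1 j = Coded.bit x.1.2 j := fun j => by
          cases Coded.bit x.1.1 j <;> cases Coded.bit x.1.2 j <;> simp
        simp only [hj]
        refine ⟨fun h j _ => by rw [h], fun h => Coded.bit_injective (funext fun j => ?_)⟩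
        by_cases hjn : j < n
        · exact h j hjn
        · rw [Coded.bit_eq_false _ _ (((size_fst_le x.1).trans x.2).trans (by omega)),
            Coded.bit_eq_false _ _ (((size_snd_le x.1).trans x.2).trans (by omega))]
    · refine (Computes.const false).mono ?_ ?_
      · simp
      · rw [Set.singleton_subset_iff, Set.mem_singleton_iff]
        funext x
        change (_ && decide (i = 0)) = _
        simp [hi]
  refine (hw.comp (hf.pair hg)).of_eq fun κ a => ?_
  simp

theorem PolyTime.and {f g : ℕ → α → Bool} (hf : PolyTime f) (hg : PolyTime g) :
    PolyTime fun κ a => f κ a && g κ a :=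
  (PolyTime.bite hf hg (.const false)).of_eq fun κ a => by cases f κ a <;> simp

theorem PolyTime.not {f : ℕ → α → Bool} (hf : PolyTime f) : PolyTime fun κ a => !f κ a :=
  (PolyTime.bite hf (.const false) (.const true)).of_eq fun κ a => by cases f κ a <;> simp

/-! Tuples -/

theorem PolyTime.apply {k : ℕ} {f : ℕ → α → Fin k → β} (hf : PolyTime f) (j : Fin k) :
    PolyTime fun κ a => f κ a j := by
  refine PolyTime.comp (h := fun _ (x : Fin k → β) => x j) (.of_wiring Polynomial.X
    (fun κ x => ?_) fun κ i => Or.inl ⟨j.val + k * i, fun x => ?_⟩) hf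
  · rw [Polynomial.eval_X]
    refine le_trans ?_ (Nat.le_add_left _ _)
    exact (Finset.le_sup (f := fun j => Coded.size (x j)) (Finset.mem_univ j)).trans
      (Nat.le_mul_of_pos_left _ j.pos)
  · have hk : 0 < k := j.pos
    have h1 : Coded.bit x (j.val + k * i) = if h : 0 < k then
        Coded.bit (x ⟨(j.val + k * i) % k, Nat.mod_lt _ h⟩) ((j.val + k * i) / k) else false :=
      rfl
    have h2 : (j.val + k * i) % k = j.val := by
      rw [Nat.add_mul_mod_self_left, Nat.mod_eq_of_lt j.isLt]
    have h3 : (j.val + k * i) / k = i := by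
      rw [Nat.add_mul_div_left _ _ hk, Nat.div_eq_of_lt j.isLt, zero_add]
    simp only [h1, dif_pos hk, h2, h3]

theorem PolyTime.cons {k : ℕ} {f : ℕ → α → β} {g : ℕ → α → Fin k → β} (hf : PolyTime f)
    (hg : PolyTime g) :
    PolyTime fun κ a => (Fin.cons (f κ a) (g κ a) : Fin (k + 1) → β) := by
  refine PolyTime.comp (h := fun _ (x : β × (Fin k → β)) => (Fin.cons x.1 x.2 : Fin (k + 1) → β))
    (.of_wiring (((k + 1 : ℕ) : Polynomial ℕ) * Polynomial.X) (fun κ x => ?_) fun κ i => Or.inl ?_) (hf.pair hg)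
  · rw [Polynomial.eval_mul, Polynomial.eval_natCast, Polynomial.eval_X]
    refine Nat.mul_le_mul_left _ ((Finset.sup_le fun j _ => ?_).trans (Nat.le_add_left _ _))
    refine Fin.cases ?_ (fun j => ?_) j
    · exact size_fst_le x
    · refine le_trans ?_ (size_snd_le x)
      exact (Finset.le_sup (f := fun j => Coded.size (x.2 j)) (Finset.mem_univ j)).trans
        (Nat.le_mul_of_pos_left _ j.pos)
  · have h1 : ∀ x : β × (Fin k → β), Coded.bit (Fin.cons x.1 x.2 : Fin (k + 1) → β) i =
        Coded.bit ((Fin.cons x.1 x.2 : Fin (k + 1) → β)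
          ⟨i % (k + 1), Nat.mod_lt _ k.succ_pos⟩) (i / (k + 1)) := fun x => rfl
    simp only [h1]
    generalize (⟨i % (k + 1), Nat.mod_lt _ k.succ_pos⟩ : Fin (k + 1)) = j
    refine Fin.cases ⟨_, fun x => bit_fst x _⟩ (fun j => ?_) j
    have hk : 0 < k := j.pos
    refine ⟨2 * (j.val + k * (i / (k + 1))) + 1, fun x => ?_⟩
    rw [← bit_snd]
    have h2 : (j.val + k * (i / (k + 1))) % k = j.val := by
      rw [Nat.add_mul_mod_self_left, Nat.mod_eq_of_lt j.isLt]
    have h3 : (j.val + k * (i / (k + 1))) / k = i / (k + 1) := by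
      rw [Nat.add_mul_div_left _ _ hk, Nat.div_eq_of_lt j.isLt, zero_add]
    have h4 : Coded.bit x.2 (j.val + k * (i / (k + 1))) = if h : 0 < k then
        Coded.bit (x.2 ⟨(j.val + k * (i / (k + 1))) % k, Nat.mod_lt _ h⟩)
          ((j.val + k * (i / (k + 1))) / k) else false := rfl
    simp only [h4, dif_pos hk, h2, h3, Fin.cons_succ]

theorem PPT.sampleAll {k : ℕ} {p : Fin k → ℕ → α → PMF β} (hp : ∀ j, PPT (p j)) :
    PPT fun κ a => sampleAll fun j => p j κ a := by
  induction k with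
  | zero => exact (PPT.const Fin.elim0).of_eq fun κ a => rfl
  | succ k ih =>
    refine ((hp 0).bind (h := fun κ a b => (EVoting.sampleAll fun j : Fin k =>
      p j.succ κ a).map fun v => (Fin.cons b v : Fin (k + 1) → β)) ?_).of_eq fun κ a => rfl
    refine PPT.map (f := fun κ (x : α × β) => EVoting.sampleAll fun j : Fin k => p j.succ κ x.1)
      (h := fun κ x v => (Fin.cons x.2 v : Fin (k + 1) → β))
      ((ih fun j => hp j.succ).comp PolyTime.id.fst) ?_
    exact .cons PolyTime.id.fst.snd PolyTime.id.snd

theorem sampleAll_pure {ι : Type} {k : ℕ} (v : Fin k → ι) :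
    sampleAll (fun j => PMF.pure (v j)) = PMF.pure v := by
  induction k with
  | zero => exact congrArg PMF.pure (Subsingleton.elim _ _)
  | succ k ih =>
    change (PMF.pure (v 0)).bind (fun a => (sampleAll fun j : Fin k =>
      PMF.pure (v j.succ)).bind fun w => PMF.pure (Fin.cons a w : Fin (k + 1) → ι)) = _
    rw [ih, PMF.pure_bind, PMF.pure_bind]
    congr 1
    exact Fin.cons_self_tail v

/-- A deterministic tuple is an independent sample from point masses. -/
theorem PolyTime.tuple {k : ℕ} {f : Fin k → ℕ → α → β} (hf : ∀ j, PolyTime (f j)) :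
    PolyTime fun κ a j => f j κ a :=
  (PPT.sampleAll hf).of_eq fun _ _ => sampleAll_pure _

/-- A family indexed by `Bool` and the pair of its values have the same code, so passing from one to
the other does nothing to the bits. -/
theorem PolyTime.boolApply {f : ℕ → α → Bool → β} (hf : PolyTime f) (b : Bool) :
    PolyTime fun κ a => f κ a b := by
  refine PolyTime.comp (h := fun _ (x : β × β) => if b then x.2 else x.1) ?_
    (PolyTime.comp (h := fun _ (x : Bool → β) => (x false, x true))
      (.of_wiring Polynomial.X (fun κ x => ?_) fun κ i => Or.inl ⟨i, fun x => rfl⟩) hf)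
    |>.of_eq fun κ a => by cases b <;> rfl
  · cases b
    · exact PolyTime.id.fst
    · exact PolyTime.id.snd
  · rw [Polynomial.eval_X]
    exact Nat.le_add_left _ _

theorem PolyTime.boolTuple {f : Bool → ℕ → α → β} (hf : ∀ b, PolyTime (f b)) :
    PolyTime fun κ a b => f b κ a := by
  refine PolyTime.comp (h := fun _ (x : β × β) b => if b then x.2 else x.1)
      (.of_wiring Polynomial.X (fun κ x => ?_) fun κ i => Or.inl ⟨i, fun x => rfl⟩)
      ((hf false).pair (hf true)) |>.of_eq fun κ a => by funext b; cases b <;> rfl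
  rw [Polynomial.eval_X]
  exact Nat.le_add_left _ _

/-! Options -/

theorem PolyTime.some {f : ℕ → α → β} (hf : PolyTime f) :
    PolyTime fun κ a => Option.some (f κ a) := by
  refine PolyTime.comp (h := fun _ (x : β) => Option.some x) (.of_wiring (Polynomial.X + 1)
    (fun κ x => ?_) fun κ i => ?_) hf
  · simp only [Polynomial.eval_add, Polynomial.eval_X, Polynomial.eval_one]
    change Coded.size x + 1 ≤ _
    omega
  · rcases i with _ | i
    · exact Or.inr ⟨true, fun x => rfl⟩
    · exact Or.inl ⟨i, fun x => rfl⟩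

theorem PolyTime.isSome {f : ℕ → α → Option β} (hf : PolyTime f) :
    PolyTime fun κ a => (f κ a).isSome := by
  refine PolyTime.comp (h := fun _ (x : Option β) => x.isSome) (.of_wiring 1
    (fun κ x => by simp [Coded.size]) fun κ i => ?_) hf
  rcases i with _ | i
  · exact Or.inl ⟨0, fun x => by cases x <;> rfl⟩
  · exact Or.inr ⟨false, fun x => by cases x <;> rfl⟩

theorem PolyTime.getD {f : ℕ → α → Option β} (hf : PolyTime f) (d : β) :
    PolyTime fun κ a => (f κ a).getD d := by
  refine PolyTime.comp (h := fun _ (x : Option β) => x.getD d) (.of_bits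
    (Polynomial.X + Polynomial.C (Coded.size d)) 7 (fun κ x => ?_) fun κ n i => ?_) hf
  · simp only [Polynomial.eval_add, Polynomial.eval_X, Polynomial.eval_C]
    cases x with
    | none => exact Nat.le_add_left _ _
    | some x =>
      change Coded.size x ≤ κ + (Coded.size x + 1) + _
      omega
  · rw [Polynomial.eval_ofNat]
    have h1 : Computes (inputs (Option β) n) 1 {fun x => Coded.bit x.1 0} := .input ⟨_, rfl⟩
    have h2 : Computes (inputs (Option β) n) 1 {fun x => Coded.bit x.1 (i + 1)} :=
      .input ⟨_, rfl⟩
    refine (h1.mux h2 (.const (Coded.bit d i))).mono le_rfl ?_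
    rw [Set.singleton_subset_iff, Set.mem_singleton_iff]
    funext ⟨x, _⟩
    cases x <;> rfl

/-- The circuit for `g` is evaluated in any case, on `default` if there is no value, and the flag
selects the output. -/
theorem PolyTime.optionBind [Inhabited β] {f : ℕ → α → Option β} {g : ℕ → α → β → Option γ}
    (hf : PolyTime f) (hg : PolyTime fun κ (x : α × β) => g κ x.1 x.2) :
    PolyTime fun κ a => (f κ a).bind (g κ a) :=
  (PolyTime.bite hf.isSome (hg.comp (PolyTime.id.pair (hf.getD default)))
    (.const none)).of_eq fun κ a => by cases f κ a <;> rfl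

theorem PolyTime.optionFilter [Inhabited β] {f : ℕ → α → Option β} {g : ℕ → α → β → Bool}
    (hf : PolyTime f) (hg : PolyTime fun κ (x : α × β) => g κ x.1 x.2) :
    PolyTime fun κ a => (f κ a).filter (g κ a) :=
  (hf.optionBind (g := fun κ a b => if g κ a b then Option.some b else none)
    (.bite hg PolyTime.id.snd.some (.const none))).of_eq fun κ a => by
      cases f κ a with
      | none => rfl
      | some b => simp [Option.filter]

theorem PPT.coins : PPT fun κ (_ : α) => coins κ := by
  rw [ppt_iff]
  refine ⟨10 * Polynomial.X + 10, fun κ n => ⟨κ, fun _ r => List.ofFn r, 2 * κ * 1 + 1, ?_, ?_, ?_,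
    fun _ => rfl⟩⟩
  · have hc : ∀ i, Computes (wires α n κ) 1
        -- The length is known, so even bits are constants; odd bits are coins or padding.
        {fun x => Coded.bit (α := Str) (List.ofFn x.2) i} := by
      intro i
      rcases Nat.mod_two_eq_zero_or_one i with hi | hi
      · have : ∀ r : Fin κ → Bool, Coded.bit (α := Str) (List.ofFn r) i =
            decide (i / 2 < κ) := fun r => by
          change (if i % 2 = 0 then _ else _) = _
          rw [if_pos hi, List.length_ofFn]
        simp only [this]
        exact .const _
      · have : ∀ r : Fin κ → Bool, Coded.bit (α := Str) (List.ofFn r) i =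
            if h : i / 2 < κ then r ⟨i / 2, h⟩ else false := fun r => by
          change (if i % 2 = 0 then _ else _) = _
          rw [if_neg (by omega), List.getD_eq_getElem?_getD, List.getElem?_ofFn]
          split_ifs <;> rfl
        simp only [this]
        by_cases h : i / 2 < κ
        · simp only [dif_pos h]
          exact .input (Or.inr ⟨_, rfl⟩)
        · simp only [dif_neg h]
          exact .const _
    refine ((Computes.range_lt (2 * κ) fun i _ => hc i).union (.const false)).mono le_rfl ?_
    rintro _ ⟨i, rfl⟩
    by_cases hi : i < 2 * κ
    · exact Or.inl ⟨i, hi, rfl⟩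
    · refine Or.inr ?_
      rw [Set.mem_singleton_iff]
      funext x
      exact Coded.bit_eq_false _ _ (by
        change 2 * (List.ofFn x.2).length ≤ i
        rw [List.length_ofFn]
        omega)
  · simp only [Polynomial.eval_add, Polynomial.eval_mul, Polynomial.eval_X,
      Polynomial.eval_ofNat]
    omega
  · intro a r
    change 2 * (List.ofFn r).length ≤ _
    rw [List.length_ofFn]
    simp only [Polynomial.eval_add, Polynomial.eval_mul, Polynomial.eval_X,
      Polynomial.eval_ofNat]
    omega

end

section

/-! ### Probabilities -/

theorem Pr_nonneg (p : PMF Bool) : 0 ≤ Pr p := ENNReal.toReal_nonneg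

theorem Pr_le_one (p : PMF Bool) : Pr p ≤ 1 :=
  ENNReal.toReal_le_of_le_ofReal zero_le_one (by simpa using p.coe_le_one true)

theorem abs_Pr_sub_le_one (p q : PMF Bool) : |Pr p - Pr q| ≤ 1 := by
  rw [abs_le]
  constructor <;> linarith [Pr_nonneg p, Pr_nonneg q, Pr_le_one p, Pr_le_one q]

section
variable {ι : Type}

theorem hasSum_toReal (p : PMF ι) : HasSum (fun a => (p a).toReal) 1 := by
  have h := ENNReal.hasSum_toReal (f := p) (by simp)
  rwa [← ENNReal.tsum_toReal_eq p.apply_ne_top, p.tsum_coe, ENNReal.toReal_one] at h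

/-- Total probability as a convergent real series, so that differences of experiments can be
compared term by term. -/
theorem hasSum_Pr_bind (p : PMF ι) (f : ι → PMF Bool) :
    HasSum (fun a => (p a).toReal * Pr (f a)) (Pr (p.bind f)) := by
  have h1 : Pr (p.bind f) = (∑' a, p a * f a true).toReal := by
    rw [Pr, PMF.bind_apply]
  have h2 : ∑' a, p a * f a true ≠ ⊤ := by
    rw [← PMF.bind_apply]
    exact PMF.apply_ne_top _ _
  have h3 := ENNReal.hasSum_toReal h2
  rw [h1, ENNReal.tsum_toReal_eq (fun a => ENNReal.ne_top_of_tsum_ne_top h2 a)]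
  have h4 : ∀ a, (p a * f a true).toReal = (p a).toReal * Pr (f a) := fun a => by
    rw [ENNReal.toReal_mul, Pr]
  simp only [h4] at h3 ⊢
  exact h3.summable.hasSum

/-- An affine bound on each outcome survives averaging because the total mass is `1`. It is applied
with `c = d = 1/2` to the views of the adversary. -/
theorem Pr_bind_mono {p : PMF ι} {f : ι → PMF Bool} (c d : ℝ) {g h : ι → PMF Bool}
    (H : ∀ a ∈ p.support, Pr (f a) ≤ c + d * (Pr (g a) - Pr (h a))) :
    Pr (p.bind f) ≤ c + d * (Pr (p.bind g) - Pr (p.bind h)) := by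
  have h1 := ((hasSum_toReal p).mul_right c).add
    (((hasSum_Pr_bind p g).sub (hasSum_Pr_bind p h)).mul_left d)
  rw [one_mul] at h1
  refine hasSum_le (fun a => ?_) (hasSum_Pr_bind p f) h1
  by_cases ha : a ∈ p.support
  · have := mul_le_mul_of_nonneg_left (H a ha) (ENNReal.toReal_nonneg (a := p a))
    linarith
  · rw [PMF.mem_support_iff, not_not] at ha
    simp [ha]

theorem Pr_bind_anti {p : PMF ι} {f : ι → PMF Bool} (c d : ℝ) {g h : ι → PMF Bool}
    (H : ∀ a ∈ p.support, c + d * (Pr (g a) - Pr (h a)) ≤ Pr (f a)) :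
    c + d * (Pr (p.bind g) - Pr (p.bind h)) ≤ Pr (p.bind f) := by
  have h1 := ((hasSum_toReal p).mul_right c).add
    (((hasSum_Pr_bind p g).sub (hasSum_Pr_bind p h)).mul_left d)
  rw [one_mul] at h1
  refine hasSum_le (fun a => ?_) h1 (hasSum_Pr_bind p f)
  by_cases ha : a ∈ p.support
  · have := mul_le_mul_of_nonneg_left (H a ha) (ENNReal.toReal_nonneg (a := p a))
    linarith
  · rw [PMF.mem_support_iff, not_not] at ha
    simp [ha]

theorem Pr_pure (b : Bool) : Pr (PMF.pure b) = if b then 1 else 0 := by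
  cases b <;> simp [Pr, PMF.pure_apply]

/-- Two experiments that differ by at most `ε` unless a bad event occurs. -/
theorem abs_Pr_bind_sub_le {p : PMF ι} {f g : ι → PMF Bool} {bad : ι → Bool} {ε : ℝ}
    (H : ∀ a ∈ p.support, bad a = false → |Pr (f a) - Pr (g a)| ≤ ε) (hε : 0 ≤ ε) :
    |Pr (p.bind f) - Pr (p.bind g)| ≤ ε + Pr (p.bind fun a => PMF.pure (bad a)) := by
  have h1 := ((hasSum_toReal p).mul_right ε).add
    (hasSum_Pr_bind p fun a => PMF.pure (bad a))
  rw [one_mul] at h1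
  have h2 := (hasSum_Pr_bind p f).sub (hasSum_Pr_bind p g)
  have key : ∀ a, |(p a).toReal * Pr (f a) - (p a).toReal * Pr (g a)| ≤
      (p a).toReal * ε + (p a).toReal * Pr (PMF.pure (bad a)) := fun a => by
    rw [← mul_sub, abs_mul, abs_of_nonneg ENNReal.toReal_nonneg, ← mul_add]
    by_cases ha : a ∈ p.support
    · refine mul_le_mul_of_nonneg_left ?_ ENNReal.toReal_nonneg
      cases hb : bad a
      · linarith [H a ha hb, Pr_nonneg (PMF.pure false)]
      · rw [Pr_pure, if_pos rfl]
        linarith [abs_Pr_sub_le_one (f a) (g a)]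
    · rw [PMF.mem_support_iff, not_not] at ha
      simp [ha]
  rw [abs_le]
  constructor
  · have := hasSum_le (fun a => (abs_le.1 (key a)).1) h1.neg h2
    linarith
  · exact hasSum_le (fun a => (abs_le.1 (key a)).2) h2 h1

theorem abs_Pr_bind_sub_le' {p : PMF ι} {f g : ι → PMF Bool} {ε : ℝ}
    (H : ∀ a ∈ p.support, |Pr (f a) - Pr (g a)| ≤ ε) (hε : 0 ≤ ε) :
    |Pr (p.bind f) - Pr (p.bind g)| ≤ ε := by
  have := abs_Pr_bind_sub_le (bad := fun _ => false) (fun a ha _ => H a ha) hε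
  rwa [PMF.bind_const, Pr_pure, if_neg (by simp), add_zero] at this

theorem bind_congr {τ : Type} {p : PMF ι} {f g : ι → PMF τ} (h : ∀ a ∈ p.support, f a = g a) :
    p.bind f = p.bind g := by
  ext b
  rw [PMF.bind_apply, PMF.bind_apply]
  refine tsum_congr fun a => ?_
  by_cases ha : a ∈ p.support
  · rw [h a ha]
  · rw [PMF.mem_support_iff, not_not] at ha
    simp [ha]

theorem Pr_bind_uniform (f : Bool → PMF Bool) :
    Pr ((PMF.uniformOfFintype Bool).bind f) = (Pr (f false) + Pr (f true)) / 2 := by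
  refine (hasSum_Pr_bind _ f).unique ?_
  convert hasSum_fintype (L := .unconditional Bool) _ using 1
  simp [PMF.uniformOfFintype_apply]
  ring

theorem Pr_map_not (p : PMF Bool) : Pr (p.bind fun b => PMF.pure (!b)) = 1 - Pr p := by
  have h1 : p false + p true = 1 := by
    have := p.tsum_coe
    rw [tsum_fintype] at this
    simpa [add_comm] using this
  have h2 : (p.bind fun b => PMF.pure (!b)) true = p false := by
    rw [PMF.bind_apply, tsum_fintype]
    simp [PMF.pure_apply]
  rw [Pr, h2, Pr, eq_sub_iff_add_eq, ← ENNReal.toReal_add (p.apply_ne_top _) (p.apply_ne_top _),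
    h1, ENNReal.toReal_one]

theorem mem_support_sampleAll {k : ℕ} {p : Fin k → PMF ι} {v : Fin k → ι} :
    v ∈ (sampleAll p).support ↔ ∀ j, v j ∈ (p j).support := by
  induction k with
  | zero =>
    change v ∈ (PMF.pure Fin.elim0).support ↔ _
    simp only [PMF.support_pure, Set.mem_singleton_iff, IsEmpty.forall_iff, iff_true]
    exact Subsingleton.elim _ _
  | succ k ih =>
    change v ∈ ((p 0).bind fun a => (sampleAll fun i : Fin k => p i.succ).bind fun w =>
      PMF.pure (Fin.cons a w : Fin (k + 1) → ι)).support ↔ _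
    simp only [PMF.mem_support_bind_iff, PMF.support_pure, Set.mem_singleton_iff, ih,
      Fin.forall_fin_succ]
    constructor
    · rintro ⟨a, ha, w, hw, rfl⟩
      exact ⟨ha, hw⟩
    · rintro ⟨h0, hs⟩
      exact ⟨v 0, h0, fun i => v i.succ, hs, (Fin.cons_self_tail v).symm⟩

/-- One of several independent samples can be drawn first. -/
theorem sampleAll_eq_bind {k : ℕ} (p : Fin k → PMF ι) (j : Fin k) :
    sampleAll p = (p j).bind fun a => sampleAll (Function.update p j (PMF.pure a)) := by
  induction k with
  | zero => exact j.elim0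
  | succ k ih =>
    have hs : ∀ p : Fin (k + 1) → PMF ι, sampleAll p = (p 0).bind fun a =>
        (sampleAll fun i : Fin k => p i.succ).bind fun w =>
          PMF.pure (Fin.cons a w : Fin (k + 1) → ι) := fun _ => rfl
    refine Fin.cases ?_ (fun j => ?_) j
    · rw [hs]
      congr 1
      funext a
      rw [hs, Function.update_self, PMF.pure_bind]
      congr 2
    · rw [hs, ih (fun i => p i.succ) j]
      simp only [PMF.bind_bind]
      rw [PMF.bind_comm]
      congr 1
      funext a
      rw [hs, Function.update_of_ne (Fin.succ_ne_zero j).symm]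
      congr 1
      funext b
      congr 2
      funext i
      by_cases hi : i = j
      · subst hi; simp
      · rw [Function.update_of_ne hi, Function.update_of_ne (by simpa using hi)]

theorem sampleAll_map {τ : Type} {k : ℕ} (p : Fin k → PMF ι) (f : Fin k → ι → τ) :
    sampleAll (fun j => (p j).map (f j)) = (sampleAll p).map fun v j => f j (v j) := by
  induction k with
  | zero =>
    change PMF.pure _ = (PMF.pure _).map _
    rw [PMF.pure_map]
    exact congrArg PMF.pure (Subsingleton.elim _ _)
  | succ k ih =>
    change ((p 0).map (f 0)).bind (fun a => (sampleAll fun i : Fin k =>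
      (p i.succ).map (f i.succ)).bind fun w => PMF.pure (Fin.cons a w : Fin (k + 1) → τ)) =
      ((p 0).bind fun a => (sampleAll fun i : Fin k => p i.succ).bind fun w =>
          PMF.pure (Fin.cons a w : Fin (k + 1) → ι)).map _
    rw [ih (fun i => p i.succ) fun i => f i.succ, PMF.bind_map, PMF.map_bind]
    congr 1
    funext a
    rw [Function.comp_apply, PMF.bind_map, PMF.map_bind]
    congr 1
    funext w
    rw [Function.comp_apply, PMF.pure_map]
    congr 1
    funext i
    refine Fin.cases rfl (fun i => rfl) i

end

theorem length_of_mem_coins {κ : ℕ} {r : Str} (h : r ∈ (coins κ).support) : r.length = κ := by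
  rw [coins, PMF.support_map] at h
  obtain ⟨v, -, rfl⟩ := h
  exact List.length_ofFn

/-! ### Indistinguishability -/

theorem Negligible.mono {ν μ : ℕ → ℝ} (hμ : Negligible μ) (h : ∀ κ, |ν κ| ≤ μ κ) :
    Negligible ν :=
  Asymptotics.SuperpolynomialDecay.trans_abs_le hμ fun κ => (h κ).trans (le_abs_self _)

theorem Negligible.add {ν μ : ℕ → ℝ} (hν : Negligible ν) (hμ : Negligible μ) :
    Negligible fun κ => ν κ + μ κ :=
  Asymptotics.SuperpolynomialDecay.add hν hμ

theorem Negligible.zero : Negligible fun _ => 0 :=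
  Asymptotics.superpolynomialDecay_zero _ _

/-- The outputs of two experiments are computationally indistinguishable. -/
def Indist (G H : ℕ → PMF Bool) : Prop := Negligible fun κ => |Pr (G κ) - Pr (H κ)|

theorem Indist.of_le {G H : ℕ → PMF Bool} {ν : ℕ → ℝ} (hν : Negligible ν)
    (h : ∀ κ, |Pr (G κ) - Pr (H κ)| ≤ ν κ) : Indist G H :=
  hν.mono fun κ => by rw [abs_abs]; exact h κ

theorem Indist.refl (G : ℕ → PMF Bool) : Indist G G :=
  Indist.of_le .zero fun κ => by simp

theorem Indist.symm {G H : ℕ → PMF Bool} (h : Indist G H) : Indist H G :=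
  Indist.of_le h fun κ => by rw [abs_sub_comm]

theorem Indist.trans {G H K : ℕ → PMF Bool} (h : Indist G H) (h' : Indist H K) : Indist G K :=
  Indist.of_le (h.add h') fun _ => abs_sub_le _ _ _

/-- Replacing the components of a family one after the other. -/
theorem Indist.hybrid {ι : Type} {N : ℕ} (G : (Fin N → ι) → ℕ → PMF Bool) (P : ι → Prop)
    {p q : Fin N → ι} (hp : ∀ j, P (p j)) (hq : ∀ j, P (q j))
    (h : ∀ v : Fin N → ι, (∀ j, P (v j)) → ∀ j,
      Indist (G (Function.update v j (p j))) (G (Function.update v j (q j)))) :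
    Indist (G p) (G q) := by
  -- The first `k` components are already replaced. As `N` does not depend on the security
  -- parameter, transitivity suffices to add up the steps; `P` holds for every mixed family.
  have key : ∀ k ≤ N, Indist (G p) (G fun j => if j.val < k then q j else p j) := by
    intro k
    induction k with
    | zero => intro _; simpa using Indist.refl _
    | succ k ih =>
      intro hk
      refine (ih (by omega)).trans ?_
      have := h (fun j => if j.val < k then q j else p j)
        (fun j => by split_ifs; exacts [hq j, hp j]) ⟨k, hk⟩
      convert this using 2
      · symm
        rw [Function.update_eq_self_iff]
        simp
      · funext j
        by_cases hj : j = ⟨k, hk⟩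
        · subst hj; simp
        · rw [Function.update_of_ne hj]
          have : j.val ≠ k := fun h => hj (Fin.ext h)
          have : j.val < k + 1 ↔ j.val < k := by omega
          simp only [this]
  simpa using key N le_rfl

/-- Witness indistinguishability when statement, witnesses and the further input of the
distinguisher are chosen by an efficient algorithm. -/
theorem IsNIWI.indist_of_sampler {X W γ : Type} [Coded X] [Coded W] [Coded γ]
    {R : ℕ → X → W → Prop} {P : ProofSystem X W} (hP : IsNIWI R P) {C : ℕ → PMF γ}
    (hC : PPT fun κ (_ : Bool) => C κ) {x : ℕ → γ → X} {w₀ w₁ : ℕ → γ → W} (hx : PolyTime x)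
    (hw₀ : PolyTime w₀) (hw₁ : PolyTime w₁) {D : ℕ → γ → Str → PMF Bool}
    (hD : PPT fun κ (c : γ × Str) => D κ c.1 c.2) :
    ∃ ν : ℕ → ℝ, Negligible ν ∧ (∀ κ, 0 ≤ ν κ) ∧ ∀ κ, ∀ c ∈ (C κ).support,
      R κ (x κ c) (w₀ κ c) → R κ (x κ c) (w₁ κ c) →
        |Pr ((P.prove κ (x κ c) (w₀ κ c)).bind (D κ c)) -
          Pr ((P.prove κ (x κ c) (w₁ κ c)).bind (D κ c))| ≤ ν κ := by
  classical
  obtain ⟨p, hp⟩ := hC.size_le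
  obtain ⟨q, hq⟩ := (hx.pair (hw₀.pair hw₁)).size_le
  have hb : Coded.size true = 1 := rfl
  let good : ℕ → γ → Prop := fun κ c =>
    c ∈ (C κ).support ∧ R κ (x κ c) (w₀ κ c) ∧ R κ (x κ c) (w₁ κ c)
  let d : ℕ → γ → ℝ := fun κ c => |Pr ((P.prove κ (x κ c) (w₀ κ c)).bind (D κ c)) -
          Pr ((P.prove κ (x κ c) (w₁ κ c)).bind (D κ c))|
  have hd : ∀ κ c, 0 ≤ d κ c ∧ d κ c ≤ 1 := fun κ c =>
    ⟨abs_nonneg _, abs_Pr_sub_le_one _ _⟩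
  -- For each `κ` an almost worst sample is chosen: its advantage is at least half the supremum over
  -- the good samples, which avoids showing that the supremum is attained. If no sample is good, any
  -- one will do.
  have hex : ∀ κ, ∃ c ∈ (C κ).support, ∀ c', good κ c' → good κ c ∧ d κ c' ≤ 2 * d κ c := by
    intro κ
    by_cases hg : ∃ c, good κ c ∧ 0 < d κ c
    · obtain ⟨c₀, hc₀, hd₀⟩ := hg
      have hbdd : BddAbove (d κ '' {c | good κ c}) := by
        refine ⟨1, ?_⟩
        rintro _ ⟨c, -, rfl⟩
        exact (hd κ c).2
      have hpos : 0 < sSup (d κ '' {c | good κ c}) :=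
        hd₀.trans_le (le_csSup hbdd ⟨c₀, hc₀, rfl⟩)
      obtain ⟨_, ⟨c, hc, rfl⟩, hlt⟩ := exists_lt_of_lt_csSup
        (Set.Nonempty.image (s := {c | good κ c}) (d κ) ⟨c₀, hc₀⟩)
        (half_lt_self hpos)
      refine ⟨c, hc.1, fun c' hc' => ⟨hc, ?_⟩⟩
      have := le_csSup hbdd ⟨c', hc', rfl⟩
      linarith
    · push Not at hg
      by_cases hg' : ∃ c, good κ c
      · obtain ⟨c, hc⟩ := hg'
        refine ⟨c, hc.1, fun c' hc' => ⟨hc, ?_⟩⟩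
        have := hg c' hc'
        have := (hd κ c).1
        linarith
      · obtain ⟨c, hc⟩ := (C κ).support_nonempty
        exact ⟨c, hc, fun c' hc' => (hg' ⟨c', hc'⟩).elim⟩
  choose c hc hmax using hex
  have hsize : ∀ κ, Coded.size (c κ) ≤ (p.comp (Polynomial.X + 1)).eval κ := fun κ => by
    have := hp κ true (c κ) (hc κ)
    rw [hb] at this
    simpa [Polynomial.eval_comp] using this
  -- Non-uniformity enters here: the chosen sample, of polynomial size, is wired into the
  -- distinguisher as advice.
  obtain ⟨ν, hν, hWI⟩ := hP.witness_indistinguishable (fun κ => D κ (c κ))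
    (hD.comp (f := fun κ (π : Str) => (c κ, π)) ((PolyTime.const' _ hsize).pair .id))
    (q.comp (Polynomial.X + p.comp (Polynomial.X + 1)))
  -- The factor `2` pays for the almost worst choice; the absolute value is taken since `ν` may be
  -- negative.
  refine ⟨fun κ => 2 * |ν κ|, ?_, fun κ => by positivity, fun κ c' h1 h2 h3 => ?_⟩
  · have h2 := hν.add hν
    refine Asymptotics.SuperpolynomialDecay.trans_abs_le h2 fun κ => ?_
    rw [← two_mul, abs_mul, abs_mul, abs_abs]
  · obtain ⟨hg, hle⟩ := hmax κ c' ⟨h1, h2, h3⟩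
    refine hle.trans (mul_le_mul_of_nonneg_left ?_ zero_le_two)
    refine (hWI κ _ _ _ ?_ hg.2.1 hg.2.2).trans (le_abs_self _)
    rw [Polynomial.eval_comp, Polynomial.eval_add, Polynomial.eval_X]
    exact (hq κ (c κ)).trans (eval_le_eval q (Nat.add_le_add_left (hsize κ) _))

end

section

namespace Full

variable {N : ℕ} {M S : Set Str} {σ : Type}

/-! ### Experiments -/

/-- The data on which the privacy of the scheme rests. -/
structure Assumptions (F : (Fin N → Option M) → Option S) (E : PKE) (com : ℕ → Str → Str → Str)
    (enc : ProofSystem (EncStatement N) EncWitness)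
    (dec : ProofSystem (DecStatement N) DecWitness) : Prop where
  pos : 0 < N
  isTally : IsTallyFunction F
  tally_efficient : PolyTime fun (_ : ℕ) (v : Fin N → Option Str) => tally F v
  msg : votes M ⊆ E.msg
  efficient : E.Efficient
  correct : E.PerfectlyCorrect
  cpa : E.INDCPA
  commitment : IsCommitment com
  enc : IsNIWI (encRel M E com) enc
  dec : IsNIWI (decRel F E) dec

/-- The public key together with the coins of its commitment. -/
abbrev OpenedKey : Type := PubKey × Str

/-- The coins and keys of an experiment, and the query and state of the adversary. -/
abbrev View (N : ℕ) (σ : Type) : Type :=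
  (OpenedKey × (Fin 3 → Str)) × (Query N Ballot × σ)

/-- Samplers of honest ballots. -/
abbrev Sampler (N : ℕ) : Type := ℕ → OpenedKey × Query N Ballot → PMF Ballot

/-- The vote, replaced by `⊥` if it is not admissible. -/
def cleanVote (F : (Fin N → Option M) → Option S) (v : Option Str) : Option Str :=
  if (tally F fun _ => v).isSome then v else none

/-- The public keys that belong to the given coins. -/
def pubKeys (E : PKE) (κ : ℕ) (s : Fin 3 → Str) : Fin 3 → Str := fun l => (E.setup κ (s l)).1

/-- The adversary's ballot with index `j`, if it is accepted. -/
def accepted (enc : ProofSystem (EncStatement N) EncWitness) (κ : ℕ) (pk : PubKey)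
    (q : Query N Ballot) (j : Fin N) : Option Ballot :=
  (q.2.2 false j).filter fun b => verifyBallot enc κ pk j b

/-- The votes in the adversary's ballots, according to the `i`-th ciphertexts. -/
def decVotes (E : PKE) (enc : ProofSystem (EncStatement N) EncWitness) (κ : ℕ) (i : Fin 3)
    (v : View N σ) : Fin N → Option Str := fun j =>
  if v.2.1.1 j then (accepted enc κ v.1.1.1 v.2.1 j).bind fun b =>
    E.decrypt κ (E.setup κ (v.1.2 i)).2 (b.1 i) else none

/-- The tuple `m_b` of the query, with the dishonest votes replaced by `d`. -/
def votesWith (d : Fin N → Option Str) (q : Query N Ballot) (b : Bool) :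
    Fin N → Option Str :=
  fun j => if q.1 j then d j else q.2.1 b j

/-- An efficiently decidable necessary condition for the validity of the query, which uses the
secret keys with indices `i 0` and `i 1`. -/
def gate (F : (Fin N → Option M) → Option S) (E : PKE)
    (enc : ProofSystem (EncStatement N) EncWitness) (κ : ℕ) (i : Fin 2 → Fin 3)
    (v : View N σ) : Bool :=
  decide (decVotes E enc κ (i 0) v = decVotes E enc κ (i 1) v) &&
  (decide ((fun j => if v.2.1.1 j then v.2.1.2.2 false j else none) =
    fun j => if v.2.1.1 j then v.2.1.2.2 true j else none) &&
  (decide ((fun b j => if v.2.1.1 j then none else cleanVote F (v.2.1.2.1 b j)) =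
    fun b j => if v.2.1.1 j then none else v.2.1.2.1 b j) &&
  -- Of the condition over all `d`, only the instance of the decrypted votes is kept.
  decide (tally F (votesWith (decVotes E enc κ (i 0) v) v.2.1 false) =
    tally F (votesWith (decVotes E enc κ (i 0) v) v.2.1 true))))

/-- The result of the election according to the query and the `i`-th ciphertexts. -/
def result (F : (Fin N → Option M) → Option S) (E : PKE)
    (enc : ProofSystem (EncStatement N) EncWitness) (κ : ℕ) (i : Fin 3) (v : View N σ) :
    Option Str :=
  tally F (votesWith (decVotes E enc κ i v) v.2.1 false)

def decStatement (F : (Fin N → Option M) → Option S) (E : PKE)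
    (enc : ProofSystem (EncStatement N) EncWitness) (κ : ℕ) (i : Fin 2 → Fin 3)
    (c : View N σ × (Fin N → Option Ballot)) : DecStatement N :=
  (c.2, c.1.1.1.1.1, result F E enc κ (i 0) c.1)

def decWitness (E : PKE) (κ : ℕ) (i : Fin 2 → Fin 3)
    (c : View N σ × (Fin N → Option Ballot)) : DecWitness :=
  (fun l => (E.setup κ (c.1.1.2 (i l))).2, fun l => c.1.1.2 (i l), i)

/-- The last stage of the adversary, applied to the ballots, the result and its proof. -/
def respond (F : (Fin N → Option M) → Option S) (E : PKE)
    (enc : ProofSystem (EncStatement N) EncWitness)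
    (A : EVote.Adversary N PubKey Ballot Str σ) (κ : ℕ) (i : Fin 2 → Fin 3)
    (c : View N σ × (Fin N → Option Ballot)) (γ : Str) : PMF Bool :=
  A.guess κ (c.1.2.2, c.2,
    -- If all ballots are `⊥`, the proof has been drawn but is dropped; thus `finish` needs no such
    -- case distinction.
    if decide (c.2 = fun _ => none) then (none, none)
    else (result F E enc κ (i 0) c.1, some γ))

/-- Tallying with the keys `i 0` and `i 1`, and the last stage of the adversary. -/
def finish (F : (Fin N → Option M) → Option S) (E : PKE)
    (enc : ProofSystem (EncStatement N) EncWitness)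
    (dec : ProofSystem (DecStatement N) DecWitness)
    (A : EVote.Adversary N PubKey Ballot Str σ) (κ : ℕ) (i : Fin 2 → Fin 3)
    (c : View N σ × (Fin N → Option Ballot)) : PMF Bool :=
  if gate F E enc κ i c.1 then
    (dec.prove κ (decStatement F E enc κ i c) (decWitness E κ i c)).bind (respond F E enc A κ i c)
  else PMF.pure false

/-- Honest ballots for the `b`-th votes, with the ordinary witness. -/
def ordinary (F : (Fin N → Option M) → Option S) (E : PKE)
    (enc : ProofSystem (EncStatement N) EncWitness) (b : Bool) (j : Fin N) : Sampler N :=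
  fun κ x => cast E enc κ x.1.1 j (cleanVote F (x.2.2.1 b j))

/-- Honest ballots whose proof uses the coins of the commitment; the `l`-th ciphertext encrypts
the vote with index `β l`. -/
def trapdoor (F : (Fin N → Option M) → Option S) (E : PKE)
    (enc : ProofSystem (EncStatement N) EncWitness) (β : Fin 3 → Bool) (j : Fin N) : Sampler N :=
  fun κ x => (sampleAll fun l => (coins κ).map
      (E.encrypt κ (x.1.1.1 l) (cleanVote F (x.2.2.1 (β l) j)))).bind fun Ct =>
    (enc.prove κ (j, Ct, x.1.1.1, x.1.1.2) (none, fun _ => [], x.1.2)).map fun π => (Ct, π)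

/-- The ballot with index `j`. -/
def slot (enc : ProofSystem (EncStatement N) EncWitness) (h : Sampler N) (j : Fin N) (κ : ℕ)
    (x : OpenedKey × Query N Ballot) : PMF (Option Ballot) :=
  if x.2.1 j then PMF.pure (accepted enc κ x.1.1 x.2 j) else (h κ x).map some

/-- Key generation and the first stage of the adversary, for a given commitment. -/
def viewFrom (E : PKE) (A : EVote.Adversary N PubKey Ballot Str σ) (κ : ℕ) (Z u : Str) :
    PMF (View N σ) :=
  (sampleAll fun _ : Fin 3 => coins κ).bind fun s =>
    (A.query κ (pubKeys E κ s, Z)).map fun x => ((((pubKeys E κ s, Z), u), s), x)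

/-- Key generation and the first stage of the adversary, with a commitment to `z`. -/
def view (E : PKE) (com : ℕ → Str → Str → Str) (A : EVote.Adversary N PubKey Ballot Str σ)
    (z : Bool) (κ : ℕ) : PMF (View N σ) :=
  (coins κ).bind fun u => viewFrom E A κ (com κ [z] u) u

/-- All ballots. -/
def ballots (enc : ProofSystem (EncStatement N) EncWitness) (h : Fin N → Sampler N) (κ : ℕ)
    (v : View N σ) : PMF (Fin N → Option Ballot) :=
  sampleAll fun j => slot enc (h j) j κ (v.1.1, v.2.1)

/-- Everything that follows the query. -/
def afterQuery (F : (Fin N → Option M) → Option S) (E : PKE)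
    (enc : ProofSystem (EncStatement N) EncWitness)
    (dec : ProofSystem (DecStatement N) DecWitness)
    (A : EVote.Adversary N PubKey Ballot Str σ) (i : Fin 2 → Fin 3)
    (h : Fin N → Sampler N) (κ : ℕ) (v : View N σ) : PMF Bool :=
  (ballots enc h κ v).bind fun B => finish F E enc dec A κ i (v, B)

/-- The hybrid experiment with a commitment to `z`, tallying with the keys `i 0` and `i 1`, and
honest ballots from `h`. -/
def hyb (F : (Fin N → Option M) → Option S) (E : PKE) (com : ℕ → Str → Str → Str)
    (enc : ProofSystem (EncStatement N) EncWitness)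
    (dec : ProofSystem (DecStatement N) DecWitness)
    (A : EVote.Adversary N PubKey Ballot Str σ) (z : Bool) (i : Fin 2 → Fin 3)
    (h : Fin N → Sampler N) (κ : ℕ) : PMF Bool :=
  (view E com A z κ).bind (afterQuery F E enc dec A i h κ)

/-- Some accepted ballot of the adversary does not contain the same vote three times. -/
def bad (E : PKE) (enc : ProofSystem (EncStatement N) EncWitness) (κ : ℕ) (v : View N σ) : Bool :=
  !(decide (decVotes E enc κ 0 v = decVotes E enc κ 1 v) &&
    decide (decVotes E enc κ 0 v = decVotes E enc κ 2 v))

/-! ### Efficiency of the experiments -/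

section Efficiency

variable [Coded σ] {F : (Fin N → Option M) → Option S} {E : PKE} {com : ℕ → Str → Str → Str}
  {enc : ProofSystem (EncStatement N) EncWitness} {dec : ProofSystem (DecStatement N) DecWitness}
  {A : EVote.Adversary N PubKey Ballot Str σ} {α : Type} [Coded α]

theorem polyTime_cleanVote (H : Assumptions F E com enc dec) {f : ℕ → α → Option Str}
    (hf : PolyTime f) : PolyTime fun κ a => cleanVote F (f κ a) :=
  .bite (H.tally_efficient.comp (.tuple fun _ => hf)).isSome hf (.const none)

theorem polyTime_accepted (H : Assumptions F E com enc dec) {pk : ℕ → α → PubKey}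
    {q : ℕ → α → Query N Ballot} (hpk : PolyTime pk) (hq : PolyTime q) (j : Fin N) :
    PolyTime fun κ a => accepted enc κ (pk κ a) (q κ a) j := by
  refine ((hq.snd.snd.boolApply false).apply j).optionFilter
    (g := fun κ a b => verifyBallot enc κ (pk κ a) j b) ?_
  have hx : PolyTime fun κ (x : α × Ballot) =>
      (((j, x.2.1, (pk κ x.1).1, (pk κ x.1).2) : EncStatement N), x.2.2) :=
    (PolyTime.pair (.const j) (PolyTime.id.snd.fst.pair ((hpk.comp PolyTime.id.fst).fst.pair
      (hpk.comp PolyTime.id.fst).snd))).pair PolyTime.id.snd.snd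
  exact H.enc.verify_efficient.comp hx

theorem polyTime_decVotes (H : Assumptions F E com enc dec) (i : Fin 3) :
    PolyTime fun κ (v : View N σ) => decVotes E enc κ i v := by
  refine .tuple (f := fun j κ (v : View N σ) => decVotes E enc κ i v j) fun j => ?_
  refine .bite (PolyTime.id.snd.fst.fst.apply j) ?_ (.const none)
  refine (polyTime_accepted H PolyTime.id.fst.fst.fst PolyTime.id.snd.fst j).optionBind
    (g := fun κ (v : View N σ) b => E.decrypt κ (E.setup κ (v.1.2 i)).2 (b.1 i)) ?_
  exact H.efficient.decrypt.comp ((H.efficient.setup.comp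
    (PolyTime.id.fst.fst.snd.apply i)).snd.pair (PolyTime.id.snd.fst.apply i))

theorem polyTime_votesWith {d : ℕ → α → Fin N → Option Str} {q : ℕ → α → Query N Ballot}
    (hd : PolyTime d) (hq : PolyTime q) (b : Bool) :
    PolyTime fun κ a => votesWith (d κ a) (q κ a) b :=
  .tuple (f := fun j κ a => votesWith (d κ a) (q κ a) b j) fun j =>
    .bite (hq.fst.apply j) (hd.apply j) ((hq.snd.fst.boolApply b).apply j)

theorem polyTime_result (H : Assumptions F E com enc dec) (i : Fin 3) :
    PolyTime fun κ (v : View N σ) => result F E enc κ i v :=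
  H.tally_efficient.comp (polyTime_votesWith (polyTime_decVotes H i) PolyTime.id.snd.fst false)

theorem polyTime_gate (H : Assumptions F E com enc dec) (i : Fin 2 → Fin 3) :
    PolyTime fun κ (v : View N σ) => gate F E enc κ i v := by
  have hq : PolyTime fun _ (v : View N σ) => v.2.1 := PolyTime.id.snd.fst
  refine (PolyTime.decide_eq (polyTime_decVotes H _) (polyTime_decVotes H _)).and
    ((PolyTime.decide_eq ?_ ?_).and ((PolyTime.decide_eq ?_ ?_).and (PolyTime.decide_eq
      (H.tally_efficient.comp (polyTime_votesWith (polyTime_decVotes H _) hq _))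
      (H.tally_efficient.comp (polyTime_votesWith (polyTime_decVotes H _) hq _)))))
  · exact .tuple fun j => .bite (hq.fst.apply j) ((hq.snd.snd.boolApply _).apply j) (.const none)
  · exact .tuple fun j => .bite (hq.fst.apply j) ((hq.snd.snd.boolApply _).apply j) (.const none)
  · exact .boolTuple fun b => .tuple fun j => .bite (hq.fst.apply j) (.const none)
      (polyTime_cleanVote H ((hq.snd.fst.boolApply b).apply j))
  · exact .boolTuple fun b => .tuple fun j => .bite (hq.fst.apply j) (.const none)
      ((hq.snd.fst.boolApply b).apply j)

theorem polyTime_bad (H : Assumptions F E com enc dec) :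
    PolyTime fun κ (v : View N σ) => bad E enc κ v :=
  .not (.and (.decide_eq (polyTime_decVotes H _) (polyTime_decVotes H _))
    (.decide_eq (polyTime_decVotes H _) (polyTime_decVotes H _)))

theorem polyTime_decStatement (H : Assumptions F E com enc dec) (i : Fin 2 → Fin 3) :
    PolyTime fun κ (c : View N σ × (Fin N → Option Ballot)) => decStatement F E enc κ i c :=
  PolyTime.id.snd.pair (PolyTime.id.fst.fst.fst.fst.fst.pair
    ((polyTime_result H _).comp PolyTime.id.fst))

theorem polyTime_decWitness (H : Assumptions F E com enc dec) (i : Fin 2 → Fin 3) :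
    PolyTime fun κ (c : View N σ × (Fin N → Option Ballot)) => decWitness E κ i c :=
  PolyTime.pair
    (.tuple fun l => (H.efficient.setup.comp (PolyTime.id.fst.fst.snd.apply (i l))).snd)
    ((PolyTime.tuple fun l => PolyTime.id.fst.fst.snd.apply (i l)).pair (.const i))

theorem ppt_respond (H : Assumptions F E com enc dec) (hA : A.IsPPT) (i : Fin 2 → Fin 3) :
    PPT fun κ (c : (View N σ × (Fin N → Option Ballot)) × Str) =>
      respond F E enc A κ i c.1 c.2 := by
  refine hA.guess.comp (PolyTime.id.fst.fst.snd.snd.pair (PolyTime.id.fst.snd.pair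
    (.bite (.decide_eq PolyTime.id.fst.snd (.const _)) (.const _) (.pair ?_ ?_))))
  · exact (polyTime_result H _).comp PolyTime.id.fst.fst
  · exact PolyTime.id.snd.some

theorem ppt_finish (H : Assumptions F E com enc dec) (hA : A.IsPPT) (i : Fin 2 → Fin 3) :
    PPT fun κ (c : View N σ × (Fin N → Option Ballot)) => finish F E enc dec A κ i c := by
  refine .bite ((polyTime_gate H i).comp PolyTime.id.fst) (.bind ?_ (ppt_respond H hA i))
    (.const false)
  exact H.dec.prove_efficient.comp ((polyTime_decStatement H i).pair (polyTime_decWitness H i))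

theorem ppt_cast (H : Assumptions F E com enc dec) (j : Fin N) :
    PPT fun κ (x : PubKey × Option Str) => cast E enc κ x.1 j x.2 := by
  have hCt : PolyTime fun κ (y : (PubKey × Option Str) × (Fin 3 → Str)) =>
      fun l => E.encrypt κ (y.1.1.1 l) y.1.2 (y.2 l) :=
    .tuple fun l => H.efficient.encrypt.comp ((PolyTime.id.fst.fst.fst.apply l).pair
      (PolyTime.id.fst.snd.pair (PolyTime.id.snd.apply l)))
  refine PPT.bind (f := fun κ (_ : PubKey × Option Str) => sampleAll fun _ : Fin 3 => coins κ)
    (h := fun κ x r => (enc.prove κ (j, fun l => E.encrypt κ (x.1.1 l) x.2 (r l), x.1.1, x.1.2)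
      (x.2, r, [])).bind fun π => PMF.pure (fun l => E.encrypt κ (x.1.1 l) x.2 (r l), π))
    (.sampleAll fun _ => .coins) (.map ?_ ((hCt.comp PolyTime.id.fst).pair PolyTime.id.snd))
  exact H.enc.prove_efficient.comp (.pair (.pair (.const j) (hCt.pair
    (PolyTime.id.fst.fst.fst.pair PolyTime.id.fst.fst.snd)))
    (PolyTime.id.fst.snd.pair (PolyTime.id.snd.pair (.const []))))

theorem ppt_ordinary (H : Assumptions F E com enc dec) (b : Bool) (j : Fin N) :
    PPT (ordinary F E enc b j) :=
  (ppt_cast H j).comp (PolyTime.id.fst.fst.pair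
    (polyTime_cleanVote H ((PolyTime.id.snd.snd.fst.boolApply b).apply j)))

theorem ppt_encrypt (H : Assumptions F E com enc dec) :
    PPT fun κ (x : Str × Option Str) => (coins κ).map (E.encrypt κ x.1 x.2) :=
  .map .coins (H.efficient.encrypt.comp
    (PolyTime.id.fst.fst.pair (PolyTime.id.fst.snd.pair PolyTime.id.snd)))

/-- The proof in a ballot with given ciphertexts that uses the coins of the commitment. -/
theorem ppt_trapdoor_prove (H : Assumptions F E com enc dec) (j : Fin N) :
    PPT fun κ (x : (OpenedKey × Query N Ballot) × (Fin 3 → Str)) =>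
      (enc.prove κ (j, x.2, x.1.1.1.1, x.1.1.1.2) (none, fun _ => [], x.1.1.2)).map
        fun π => ((x.2, π) : Ballot) := by
  refine .map (H.enc.prove_efficient.comp (.pair (.pair (.const j) (PolyTime.id.snd.pair
    (PolyTime.id.fst.fst.fst.fst.pair PolyTime.id.fst.fst.fst.snd)))
    (.pair (.const none) (.pair (.const _) PolyTime.id.fst.fst.snd)))) ?_
  exact PolyTime.id.fst.snd.pair PolyTime.id.snd

theorem ppt_trapdoor (H : Assumptions F E com enc dec) (β : Fin 3 → Bool) (j : Fin N) :
    PPT (trapdoor F E enc β j) :=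
  .bind (.sampleAll fun l => (ppt_encrypt H).comp ((PolyTime.id.fst.fst.fst.apply l).pair
    (polyTime_cleanVote H ((PolyTime.id.snd.snd.fst.boolApply (β l)).apply j))))
    (ppt_trapdoor_prove H j)

theorem ppt_slot (H : Assumptions F E com enc dec) {h : Sampler N} (hh : PPT h) (j : Fin N) :
    PPT fun κ x => slot enc h j κ x :=
  .bite (PolyTime.id.snd.fst.apply j)
    (polyTime_accepted H PolyTime.id.fst.fst PolyTime.id.snd j)
    (hh.map (h := fun _ _ b => some b) PolyTime.id.snd.some)

theorem ppt_ballots (H : Assumptions F E com enc dec) {h : Fin N → Sampler N}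
    (hh : ∀ j, PPT (h j)) : PPT fun κ (v : View N σ) => ballots enc h κ v :=
  .sampleAll fun j => (ppt_slot H (hh j) j).comp (PolyTime.id.fst.fst.pair PolyTime.id.snd.fst)

theorem ppt_afterQuery (H : Assumptions F E com enc dec) (hA : A.IsPPT) (i : Fin 2 → Fin 3)
    {h : Fin N → Sampler N} (hh : ∀ j, PPT (h j)) :
    PPT fun κ (v : View N σ) => afterQuery F E enc dec A i h κ v :=
  (ppt_ballots H hh).bind (ppt_finish H hA i)

theorem ppt_viewFrom (H : Assumptions F E com enc dec) (hA : A.IsPPT) :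
    PPT fun κ (x : Str × Str) => viewFrom E A κ x.1 x.2 := by
  have hpk : PolyTime fun κ (x : (Str × Str) × (Fin 3 → Str)) => pubKeys E κ x.2 :=
    .tuple fun l => (H.efficient.setup.comp (PolyTime.id.snd.apply l)).fst
  refine .bind (.sampleAll fun _ => .coins) (.map ?_ ?_)
  · exact hA.query.comp (hpk.pair PolyTime.id.fst.fst)
  · exact ((((hpk.comp PolyTime.id.fst).pair PolyTime.id.fst.fst.fst).pair
      PolyTime.id.fst.fst.snd).pair PolyTime.id.fst.snd).pair PolyTime.id.snd

theorem ppt_view (H : Assumptions F E com enc dec) (hA : A.IsPPT) (z : Bool) :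
    PPT fun κ (_ : α) => view E com A z κ := by
  refine .bind (h := fun κ _ u => viewFrom E A κ (com κ [z] u) u) .coins
    ((ppt_viewFrom H hA).comp (.pair ?_ PolyTime.id.snd))
  exact H.commitment.efficient.comp ((PolyTime.const [z]).pair PolyTime.id.snd)

end Efficiency

end Full

end

section

/-- Lets the coins of one key pair be sampled as a placeholder and filled in afterwards, as needed
for a reduction that does not know them. -/
theorem sampleAll_update_pure {ι : Type} {k : ℕ} (p : Fin k → PMF ι) (l : Fin k) (a a' : ι) :
    sampleAll (Function.update p l (PMF.pure a)) =
      (sampleAll (Function.update p l (PMF.pure a'))).map fun s => Function.update s l a := by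
  have h := sampleAll_map (Function.update p l (PMF.pure a'))
    fun j x => if j = l then a else x
  have h1 : (fun j => (Function.update p l (PMF.pure a') j).map fun x => if j = l then a else x) =
      Function.update p l (PMF.pure a) := by
    funext j
    by_cases hj : j = l
    · subst hj
      simp [PMF.pure_map]
    · simp only [hj, if_false, Function.update_of_ne, ne_eq, not_false_eq_true]
      exact PMF.map_id (p j)
  rw [h1] at h
  rw [h]
  congr 1
  funext s j
  by_cases hj : j = l
  · subst hj; simp
  · simp [hj]

namespace Full

variable {N : ℕ} {M S : Set Str} {σ : Type} {F : (Fin N → Option M) → Option S} {E : PKE}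
  {com : ℕ → Str → Str → Str} {enc : ProofSystem (EncStatement N) EncWitness}
  {dec : ProofSystem (DecStatement N) DecWitness} {A : EVote.Adversary N PubKey Ballot Str σ}

/-! ### Correctness -/

/-- Membership in `M` is not assumed to be efficiently decidable. As `F` is `⊥` only on the tuple of
`⊥`s and `0 < N`, the efficient tally of a constant tuple decides it; `cleanVote` relies on this. -/
theorem isSome_tally_const (H : Assumptions F E com enc dec) (v : Option Str) :
    (tally F fun _ => v).isSome ↔ ∃ x, v = some x ∧ x ∈ M := by
  have h1 : (tally F fun _ => v).isSome ↔ clean M v ≠ none := by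
    rw [tally, Option.isSome_map, Option.isSome_iff_ne_none, ne_eq, H.isTally]
    exact not_congr ⟨fun h => h ⟨0, H.pos⟩, fun h _ => h⟩
  rw [h1]
  cases v with
  | none => simp [clean]
  | some x => by_cases hx : x ∈ M <;> simp [clean, hx]

theorem cleanVote_mem (H : Assumptions F E com enc dec) (v : Option Str) :
    cleanVote F v ∈ votes M := by
  unfold cleanVote
  split_ifs with h
  · obtain ⟨x, rfl, hx⟩ := (isSome_tally_const H v).1 h
    intro y hy
    rw [Option.mem_some_iff] at hy
    exact hy ▸ hx
  · intro y hy
    simp at hy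

theorem cleanVote_of_mem (H : Assumptions F E com enc dec) {v : Option Str} (hv : v ∈ votes M) :
    cleanVote F v = v := by
  cases v with
  | none => simp [cleanVote]
  | some x => exact if_pos ((isSome_tally_const H _).2 ⟨x, rfl, hv x rfl⟩)

/-- A view with honestly generated keys. -/
structure IsView (E : PKE) (com : ℕ → Str → Str → Str) (z : Bool) (κ : ℕ) (v : View N σ) : Prop where
  length : ∀ l, (v.1.2 l).length = κ
  pubKeys : v.1.1.1.1 = pubKeys E κ v.1.2
  length_opening : v.1.1.2.length = κ
  commitment : v.1.1.1.2 = com κ [z] v.1.1.2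

theorem isView_of_mem {z : Bool} {κ : ℕ} {v : View N σ} (h : v ∈ (view E com A z κ).support) :
    IsView E com z κ v := by
  simp only [view, viewFrom, PMF.mem_support_bind_iff, PMF.support_map, Set.mem_image,
    mem_support_sampleAll] at h
  obtain ⟨u, hu, s, hs, x, -, rfl⟩ := h
  exact ⟨fun l => length_of_mem_coins (hs l), rfl, length_of_mem_coins hu, rfl⟩

/-- The `l`-th ciphertext of the ballot encrypts the admissible vote with index `β l`. -/
def Encrypts (F : (Fin N → Option M) → Option S) (E : PKE) (κ : ℕ)
    (x : OpenedKey × Query N Ballot) (j : Fin N) (β : Fin 3 → Bool) (b : Ballot) : Prop :=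
  ∃ r : Fin 3 → Str, ∀ l, (r l).length = κ ∧
    b.1 l = E.encrypt κ (x.1.1.1 l) (cleanVote F (x.2.2.1 (β l) j)) (r l)

theorem ordinary_eq (b : Bool) (j : Fin N) (κ : ℕ) (x : OpenedKey × Query N Ballot) :
    ordinary F E enc b j κ x = (sampleAll fun _ : Fin 3 => coins κ).bind fun r =>
      (enc.prove κ (j, fun l => E.encrypt κ (x.1.1.1 l) (cleanVote F (x.2.2.1 b j)) (r l),
        x.1.1.1, x.1.1.2) (cleanVote F (x.2.2.1 b j), r, [])).bind fun π =>
      PMF.pure (fun l => E.encrypt κ (x.1.1.1 l) (cleanVote F (x.2.2.1 b j)) (r l), π) := rfl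

/-- The same shape as `ordinary_eq`: for constant `β`, and admissible votes fixed, the two differ
only in the witness of the proof. -/
theorem trapdoor_eq (β : Fin 3 → Bool) (j : Fin N) (κ : ℕ) (x : OpenedKey × Query N Ballot) :
    trapdoor F E enc β j κ x = (sampleAll fun _ : Fin 3 => coins κ).bind fun r =>
      (enc.prove κ (j, fun l => E.encrypt κ (x.1.1.1 l) (cleanVote F (x.2.2.1 (β l) j)) (r l),
        x.1.1.1, x.1.1.2) (none, fun _ => [], x.1.2)).bind fun π =>
      PMF.pure (fun l => E.encrypt κ (x.1.1.1 l) (cleanVote F (x.2.2.1 (β l) j)) (r l), π) := by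
  unfold trapdoor
  rw [sampleAll_map (fun _ : Fin 3 => coins κ), PMF.bind_map]
  rfl

theorem ordinary_sound (H : Assumptions F E com enc dec) {b : Bool} {j : Fin N} {κ : ℕ}
    {x : OpenedKey × Query N Ballot} {B : Ballot} (h : B ∈ (ordinary F E enc b j κ x).support) :
    Encrypts F E κ x j (fun _ => b) B ∧ verifyBallot enc κ x.1.1 j B = true := by
  simp only [ordinary_eq, PMF.mem_support_bind_iff, PMF.support_pure, Set.mem_singleton_iff,
    mem_support_sampleAll] at h
  obtain ⟨r, hr, π, hπ, rfl⟩ := h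
  have hr' := fun l => length_of_mem_coins (hr l)
  refine ⟨⟨r, fun l => ⟨hr' l, rfl⟩⟩, H.enc.complete _ _ _ (Or.inl ⟨cleanVote_mem H _, ?_⟩) π hπ⟩
  exact fun l => ⟨hr' l, rfl⟩

/-- Acceptance of the ballot is not needed here, since the hybrid experiments verify only the
adversary's ballots. -/
theorem trapdoor_sound {β : Fin 3 → Bool} {j : Fin N} {κ : ℕ} {x : OpenedKey × Query N Ballot}
    {B : Ballot} (h : B ∈ (trapdoor F E enc β j κ x).support) : Encrypts F E κ x j β B := by
  simp only [trapdoor_eq, PMF.mem_support_bind_iff, PMF.support_pure, Set.mem_singleton_iff,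
    mem_support_sampleAll] at h
  obtain ⟨r, hr, π, hπ, rfl⟩ := h
  exact ⟨r, fun l => ⟨length_of_mem_coins (hr l), rfl⟩⟩

theorem gate_eq_true_iff {κ : ℕ} {i : Fin 2 → Fin 3} {v : View N σ} :
    gate F E enc κ i v = true ↔
      decVotes E enc κ (i 0) v = decVotes E enc κ (i 1) v ∧
      (∀ j, v.2.1.1 j = true → v.2.1.2.2 false j = v.2.1.2.2 true j) ∧
      (∀ j, v.2.1.1 j = false → ∀ b, cleanVote F (v.2.1.2.1 b j) = v.2.1.2.1 b j) ∧
      tally F (votesWith (decVotes E enc κ (i 0) v) v.2.1 false) =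
        tally F (votesWith (decVotes E enc κ (i 0) v) v.2.1 true) := by
  simp only [gate, Bool.and_eq_true, decide_eq_true_eq]
  refine and_congr Iff.rfl (and_congr ⟨fun h j hj => ?_, fun h => funext fun j => ?_⟩
    (and_congr ⟨fun h j hj b => ?_, fun h => funext fun b => funext fun j => ?_⟩ Iff.rfl))
  · simpa [hj] using congrFun h j
  · cases hj : v.2.1.1 j
    · simp
    · simpa using h j hj
  · simpa [hj] using congrFun (congrFun h b) j
  · cases hj : v.2.1.1 j
    · simpa using h j hj b
    · simp

/-- Honest ballots decrypt to their votes by perfect correctness, and the gate ensures that cleaning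
has not altered these; dishonest ballots agree by definition of `decVotes`. -/
theorem tallyAt_eq (H : Assumptions F E com enc dec) {z : Bool} {κ : ℕ} {v : View N σ}
    (hv : IsView E com z κ v) {i : Fin 2 → Fin 3} (hg : gate F E enc κ i v = true)
    {h : Fin N → Sampler N} {β : Fin 3 → Bool}
    (hh : ∀ j, ∀ b ∈ (h j κ (v.1.1, v.2.1)).support, Encrypts F E κ (v.1.1, v.2.1) j β b)
    {B : Fin N → Option Ballot} (hB : B ∈ (ballots enc h κ v).support) (l : Fin 3) :
    tallyAt F E κ l (E.setup κ (v.1.2 l)).2 B =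
      tally F (votesWith (decVotes E enc κ l v) v.2.1 (β l)) := by
  rw [gate_eq_true_iff] at hg
  unfold tallyAt
  congr 1
  funext j
  have hj := mem_support_sampleAll.1 hB j
  unfold slot at hj
  unfold votesWith decVotes
  dsimp only at hj ⊢
  cases hS : v.2.1.1 j
  · simp only [hS, Bool.false_eq_true, if_false, PMF.support_map, Set.mem_image] at hj ⊢
    obtain ⟨b, hb, hbj⟩ := hj
    obtain ⟨r, hr⟩ := hh j b hb
    rw [← hbj, Option.bind_some, (hr l).2]
    dsimp only
    rw [hv.pubKeys]
    refine (H.correct κ _ _ (hv.length l) (hr l).1 _ (H.msg (cleanVote_mem H _))).trans ?_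
    exact hg.2.2.1 j hS _
  · simp only [hS, if_true, PMF.support_pure, Set.mem_singleton_iff] at hj ⊢
    rw [hj]

/-- The gate makes the result independent of the key, because the dishonest votes agree under both,
and of the tuple that the honest ciphertexts encrypt. Hence `y` stays a true statement for mixed
ballots. -/
theorem result_eq_tallyAt (H : Assumptions F E com enc dec) {z : Bool} {κ : ℕ} {v : View N σ}
    (hv : IsView E com z κ v) {i : Fin 2 → Fin 3} (hg : gate F E enc κ i v = true)
    {h : Fin N → Sampler N} {β : Fin 3 → Bool}
    (hh : ∀ j, ∀ b ∈ (h j κ (v.1.1, v.2.1)).support, Encrypts F E κ (v.1.1, v.2.1) j β b)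
    {B : Fin N → Option Ballot} (hB : B ∈ (ballots enc h κ v).support) (l : Fin 2) :
    result F E enc κ (i 0) v = tallyAt F E κ (i l) (E.setup κ (v.1.2 (i l))).2 B := by
  rw [tallyAt_eq H hv hg hh hB]
  rw [gate_eq_true_iff] at hg
  have h0 : decVotes E enc κ (i l) v = decVotes E enc κ (i 0) v := by
    fin_cases l
    · rfl
    · exact hg.1.symm
  rw [h0, result]
  cases β (i l)
  · rfl
  · exact hg.2.2.2

theorem decRel_holds (H : Assumptions F E com enc dec) {z : Bool} {κ : ℕ} {v : View N σ}
    (hv : IsView E com z κ v) {i : Fin 2 → Fin 3} (hi : i 0 < i 1)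
    (hg : gate F E enc κ i v = true) {h : Fin N → Sampler N} {β : Fin 3 → Bool}
    (hh : ∀ j, ∀ b ∈ (h j κ (v.1.1, v.2.1)).support, Encrypts F E κ (v.1.1, v.2.1) j β b)
    {B : Fin N → Option Ballot} (hB : B ∈ (ballots enc h κ v).support) :
    decRel F E κ (decStatement F E enc κ i (v, B)) (decWitness E κ i (v, B)) := by
  refine ⟨hi, fun l => ⟨hv.length _, ?_⟩, Or.inr fun l => result_eq_tallyAt H hv hg hh hB l⟩
  simp only [decStatement, decWitness, hv.pubKeys]
  rfl

/-- With a commitment to `1`, an accepted ballot contains the same vote three times. -/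
theorem bad_eq_false (H : Assumptions F E com enc dec) {κ : ℕ} {v : View N σ}
    (hv : IsView E com true κ v) : bad E enc κ v = false := by
  have key : ∀ l l', decVotes E enc κ l v = decVotes E enc κ l' v := by
    intro l l'
    funext j
    unfold decVotes
    split_ifs
    · cases hb : accepted enc κ v.1.1.1 v.2.1 j with
      | none => rfl
      | some b =>
        have hver : verifyBallot enc κ v.1.1.1 j b = true := (Option.filter_eq_some_iff.1 hb).2
        obtain ⟨w, hw⟩ := H.enc.sound _ _ _ hver
        -- Either the witness is a common plaintext, or it opens a commitment to `1` as `0`, against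
        -- perfect binding.
        rcases hw with ⟨hw1, hw2⟩ | ⟨hw1, hw2⟩
        · have hd : ∀ l, E.decrypt κ (E.setup κ (v.1.2 l)).2 (b.1 l) = w.1 := fun l => by
            have h2 := (hw2 l).2
            dsimp only at h2
            rw [h2, hv.pubKeys]
            exact H.correct κ _ _ (hv.length l) (hw2 l).1 _ (H.msg hw1)
          simp only [Option.bind_some, hd]
        · exact (H.commitment.perfectly_binding κ [true] [false] _ _ hv.length_opening hw1
            (by simp) (hv.commitment.symm.trans hw2)).elim
    · rfl
  simp only [bad, Bool.not_eq_false', Bool.and_eq_true, decide_eq_true_eq]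
  exact ⟨key _ _, key _ _⟩

theorem decVotes_eq_of_not_bad {κ : ℕ} {v : View N σ} (h : bad E enc κ v = false) (l : Fin 3) :
    decVotes E enc κ l v = decVotes E enc κ 0 v := by
  simp only [bad, Bool.not_eq_false', Bool.and_eq_true, decide_eq_true_eq] at h
  fin_cases l
  · rfl
  · exact h.1.symm
  · exact h.2.symm

/-! ### Steps between hybrid experiments -/

/-- The experiment after the query, when the honest ballot with index `j` is given. -/
def complete (F : (Fin N → Option M) → Option S) (E : PKE)
    (enc : ProofSystem (EncStatement N) EncWitness)
    (dec : ProofSystem (DecStatement N) DecWitness)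
    (A : EVote.Adversary N PubKey Ballot Str σ) (i : Fin 2 → Fin 3) (h : Fin N → Sampler N)
    (j : Fin N) (κ : ℕ) (v : View N σ) (b : Ballot) : PMF Bool :=
  (sampleAll (Function.update (fun j => slot enc (h j) j κ (v.1.1, v.2.1)) j
    (PMF.pure (if v.2.1.1 j then accepted enc κ v.1.1.1 v.2.1 j else some b)))).bind
    fun B => finish F E enc dec A κ i (v, B)

/-- Isolates the honest ballot `j` as a first, independent draw, so that one ballot can be exchanged
at a time. For `j ∈ S` the draw is ignored. -/
theorem afterQuery_update (i : Fin 2 → Fin 3) (h : Fin N → Sampler N) (j : Fin N)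
    (h' : Sampler N) (κ : ℕ) (v : View N σ) :
    afterQuery F E enc dec A i (Function.update h j h') κ v =
      (h' κ (v.1.1, v.2.1)).bind (complete F E enc dec A i h j κ v) := by
  have h1 : (fun j' => slot enc (Function.update h j h' j') j' κ (v.1.1, v.2.1)) =
      Function.update (fun j' => slot enc (h j') j' κ (v.1.1, v.2.1)) j
        (slot enc h' j κ (v.1.1, v.2.1)) := by
    funext j'
    by_cases hj : j' = j
    · subst hj; simp
    · simp [hj]
  rw [afterQuery, ballots, h1, sampleAll_eq_bind _ j, Function.update_self, PMF.bind_bind]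
  simp only [Function.update_idem]
  unfold complete
  generalize (fun j' => slot enc (h j') j' κ (v.1.1, v.2.1)) = p
  unfold slot
  dsimp only
  split_ifs
  · rw [PMF.pure_bind, PMF.bind_const]
  · rw [PMF.bind_map]
    rfl

variable [Coded σ]

/-- Replacing the commitment, in experiments that do not use its coins. -/
theorem indist_commitment (H : Assumptions F E com enc dec) (hA : A.IsPPT)
    {G : ℕ → View N σ → PMF Bool} (hG : PPT G)
    (hGu : ∀ κ pk s x u, G κ (((pk, u), s), x) = G κ (((pk, []), s), x)) :
    Indist (fun κ => (view E com A true κ).bind (G κ))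
      fun κ => (view E com A false κ).bind (G κ) := by
  -- Erasing the opening leaves an experiment that a distinguisher can run from the commitment
  -- alone.
  have key : ∀ z κ, (view E com A z κ).bind (G κ) =
      (coins κ).bind fun u => (viewFrom E A κ (com κ [z] u) []).bind (G κ) := fun z κ => by
    rw [view, PMF.bind_bind]
    congr 1
    funext u
    simp only [viewFrom, PMF.bind_bind, PMF.bind_map]
    congr 2
    funext s
    congr 1
    funext x
    exact hGu _ _ _ _ _
  simp only [key]
  refine H.commitment.computationally_hiding [true] [false] rfl
    (fun κ Z => (viewFrom E A κ Z []).bind (G κ)) ?_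
  exact .bind (h := fun κ _ v => G κ v) ((ppt_viewFrom H hA).comp (PolyTime.id.pair (.const [])))
    (hG.comp PolyTime.id.snd)

/-- Soundness says nothing for a commitment to `0`. But `bad` is efficiently testable without the
opening and never occurs for a commitment to `1`, so hiding transfers the bound. -/
theorem negligible_bad (H : Assumptions F E com enc dec) (hA : A.IsPPT) :
    Negligible fun κ => Pr ((view E com A false κ).bind fun v => PMF.pure (bad E enc κ v)) := by
  refine (indist_commitment H hA (G := fun κ v => PMF.pure (bad E enc κ v)) (polyTime_bad H)
    fun _ _ _ _ _ => rfl).mono fun κ => ?_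
  have h0 : (view E com A true κ).bind (fun v => PMF.pure (bad E enc κ v)) =
      (view E com A true κ).bind fun _ => PMF.pure false :=
    bind_congr fun v hv => by rw [bad_eq_false H (isView_of_mem hv)]
  dsimp only
  rw [h0, PMF.bind_const, Pr_pure, if_neg (by simp), zero_sub, abs_neg]

/-- This precedes the change of witness because ordinary ballots do not use the opening. -/
theorem indist_hyb_commitment (H : Assumptions F E com enc dec) (hA : A.IsPPT)
    (i : Fin 2 → Fin 3) (b : Bool) :
    Indist (hyb F E com enc dec A true i (ordinary F E enc b))
      (hyb F E com enc dec A false i (ordinary F E enc b)) :=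
  indist_commitment H hA (ppt_afterQuery H hA i fun j => ppt_ordinary H b j)
    fun _ _ _ _ _ => rfl

/-- Changing the keys that are used in the tally. -/
theorem indist_hyb_keys (H : Assumptions F E com enc dec) (hA : A.IsPPT) {i i' : Fin 2 → Fin 3}
    (hi : i 0 < i 1) (hi' : i' 0 < i' 1) (β : Fin 3 → Bool) :
    Indist (hyb F E com enc dec A false i (trapdoor F E enc β))
      (hyb F E com enc dec A false i' (trapdoor F E enc β)) := by
  have hC : PPT fun κ (_ : Bool) => (view E com A false κ).bind fun v =>
      (ballots enc (trapdoor F E enc β) κ v).map fun B => (v, B) := by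
    refine .bind (h := fun κ _ v => (ballots enc (trapdoor F E enc β) κ v).map fun B => (v, B))
      (ppt_view H hA false) (.map (f := fun κ (x : Bool × View N σ) =>
        ballots enc (trapdoor F E enc β) κ x.2) (h := fun κ x B => (x.2, B)) ?_ ?_)
    · exact (ppt_ballots H fun j => ppt_trapdoor H β j).comp PolyTime.id.snd
    · exact PolyTime.id.fst.snd.pair PolyTime.id.snd
  obtain ⟨ν, hν, hν0, hle⟩ := H.dec.indist_of_sampler hC (polyTime_decStatement H i)
    (polyTime_decWitness H i) (polyTime_decWitness H i') (ppt_respond H hA i)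
  refine Indist.of_le (hν.add (negligible_bad H hA)) fun κ => ?_
  refine abs_Pr_bind_sub_le (fun v hv hb => ?_) (hν0 κ)
  -- Outside `bad` all keys give the same dishonest votes, so the gate and the tally statement
  -- coincide and only the witness changes.
  have hgate : gate F E enc κ i v = gate F E enc κ i' v := by
    simp only [gate, decVotes_eq_of_not_bad hb (i _), decVotes_eq_of_not_bad hb (i' _)]
  have hres : result F E enc κ (i 0) v = result F E enc κ (i' 0) v := by
    simp only [result, decVotes_eq_of_not_bad hb (i _), decVotes_eq_of_not_bad hb (i' _)]
  refine abs_Pr_bind_sub_le' (fun B hB => ?_) (hν0 κ)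
  unfold finish
  rw [← hgate]
  dsimp only
  by_cases hg : gate F E enc κ i v = true
  · rw [if_pos hg, if_pos hg]
    have hv' := isView_of_mem hv
    have h1 := decRel_holds H hv' hi hg (fun j b hb => trapdoor_sound hb) hB
    have h2 := decRel_holds H hv' hi' (hgate ▸ hg) (fun j b hb => trapdoor_sound hb) hB
    have hst : decStatement F E enc κ i' (v, B) = decStatement F E enc κ i (v, B) := by
      simp only [decStatement, hres]
    have hresp : respond F E enc A κ i' (v, B) = respond F E enc A κ i (v, B) := by
      funext γ
      simp only [respond, hres]
    rw [hst] at h2 ⊢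
    rw [hresp]
    refine hle κ (v, B) ?_ h1 h2
    rw [PMF.mem_support_bind_iff]
    exact ⟨v, hv, by rw [PMF.support_map]; exact ⟨B, hB, rfl⟩⟩
  · rw [if_neg hg, if_neg hg, sub_self, abs_zero]
    exact hν0 κ

theorem ppt_complete (H : Assumptions F E com enc dec) (hA : A.IsPPT) (i : Fin 2 → Fin 3)
    {h : Fin N → Sampler N} (hh : ∀ j, PPT (h j)) (j : Fin N) :
    PPT fun κ (x : View N σ × Ballot) => complete F E enc dec A i h j κ x.1 x.2 := by
  refine .bind (.sampleAll (p := fun j' κ (x : View N σ × Ballot) =>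
    Function.update (fun j' => slot enc (h j') j' κ (x.1.1.1, x.1.2.1)) j
      (PMF.pure (if x.1.2.1.1 j then accepted enc κ x.1.1.1.1 x.1.2.1 j else some x.2)) j')
    fun j' => ?_) ((ppt_finish H hA i).comp (PolyTime.id.fst.fst.pair PolyTime.id.snd))
  by_cases hj : j' = j
  · subst hj
    simp only [Function.update_self]
    exact PolyTime.bite (PolyTime.id.fst.snd.fst.fst.apply j')
      (polyTime_accepted H PolyTime.id.fst.fst.fst.fst PolyTime.id.fst.snd.fst j')
      PolyTime.id.snd.some
  · simp only [Function.update_of_ne hj]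
    exact (ppt_slot H (hh j') j').comp (PolyTime.id.fst.fst.fst.pair PolyTime.id.fst.snd.fst)

/-- Changing the witness of the proof in an honest ballot. -/
theorem indist_hyb_witness (H : Assumptions F E com enc dec) (hA : A.IsPPT) (i : Fin 2 → Fin 3)
    {h : Fin N → Sampler N} (hh : ∀ j, PPT (h j)) (j : Fin N) (b : Bool) :
    Indist (hyb F E com enc dec A false i (Function.update h j (ordinary F E enc b j)))
      (hyb F E com enc dec A false i (Function.update h j (trapdoor F E enc (fun _ => b) j))) := by
  have hC : PPT fun κ (_ : Bool) => (view E com A false κ).bind fun v =>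
      (sampleAll fun _ : Fin 3 => coins κ).map fun r => (v, r) :=
    .bind (h := fun κ _ v => (sampleAll fun _ : Fin 3 => coins κ).map fun r => (v, r))
      (ppt_view H hA false) (.map (.sampleAll fun _ => .coins)
        (PolyTime.id.fst.snd.pair PolyTime.id.snd))
  have hm : PolyTime fun κ (c : View N σ × (Fin 3 → Str)) => cleanVote F (c.1.2.1.2.1 b j) :=
    polyTime_cleanVote H ((PolyTime.id.fst.snd.fst.snd.fst.boolApply b).apply j)
  have hCt : PolyTime fun κ (c : View N σ × (Fin 3 → Str)) => fun l =>
      E.encrypt κ (c.1.1.1.1.1 l) (cleanVote F (c.1.2.1.2.1 b j)) (c.2 l) :=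
    .tuple fun l => H.efficient.encrypt.comp ((PolyTime.id.fst.fst.fst.fst.fst.apply l).pair
      (hm.pair (PolyTime.id.snd.apply l)))
  have hx : PolyTime fun κ (c : View N σ × (Fin 3 → Str)) =>
      ((j, fun l => E.encrypt κ (c.1.1.1.1.1 l) (cleanVote F (c.1.2.1.2.1 b j)) (c.2 l),
        c.1.1.1.1.1, c.1.1.1.1.2) : EncStatement N) :=
    .pair (.const j) (hCt.pair (PolyTime.id.fst.fst.fst.fst.fst.pair
      PolyTime.id.fst.fst.fst.fst.snd))
  have hw₀ : PolyTime fun κ (c : View N σ × (Fin 3 → Str)) =>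
      ((cleanVote F (c.1.2.1.2.1 b j), c.2, []) : EncWitness) :=
    hm.pair (PolyTime.id.snd.pair (.const []))
  have hw₁ : PolyTime fun (_ : ℕ) (c : View N σ × (Fin 3 → Str)) =>
      ((none, fun _ => [], c.1.1.1.2) : EncWitness) :=
    .pair (.const none) (.pair (.const _) PolyTime.id.fst.fst.fst.snd)
  have hD : PPT fun κ (c : (View N σ × (Fin 3 → Str)) × Str) =>
      complete F E enc dec A i h j κ c.1.1 (fun l =>
        E.encrypt κ (c.1.1.1.1.1.1 l) (cleanVote F (c.1.1.2.1.2.1 b j)) (c.1.2 l), c.2) :=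
    (ppt_complete H hA i hh j).comp (PolyTime.id.fst.fst.pair
      ((hCt.comp PolyTime.id.fst).pair PolyTime.id.snd))
  obtain ⟨ν, hν, hν0, hle⟩ := H.enc.indist_of_sampler hC hx hw₀ hw₁ (D := fun κ c π =>
    complete F E enc dec A i h j κ c.1 (fun l =>
        E.encrypt κ (c.1.1.1.1.1 l) (cleanVote F (c.1.2.1.2.1 b j)) (c.2 l), π)) hD
  refine Indist.of_le hν fun κ => ?_
  refine abs_Pr_bind_sub_le' (fun v hv => ?_) (hν0 κ)
  rw [afterQuery_update, afterQuery_update, ordinary_eq, trapdoor_eq, PMF.bind_bind,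
    PMF.bind_bind]
  refine abs_Pr_bind_sub_le' (fun r hr => ?_) (hν0 κ)
  simp only [PMF.bind_bind, PMF.pure_bind]
  have hv' := isView_of_mem hv
  rw [mem_support_sampleAll] at hr
  refine hle κ (v, r) ?_ (Or.inl ⟨cleanVote_mem H _, fun l => ⟨length_of_mem_coins (hr l), rfl⟩⟩)
    (Or.inr ⟨hv'.length_opening, hv'.commitment⟩)
  rw [PMF.mem_support_bind_iff]
  refine ⟨v, hv, ?_⟩
  rw [PMF.support_map]
  exact ⟨r, mem_support_sampleAll.2 hr, rfl⟩

end Full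

end

/-! ### Reduction to IND-CPA and the chain of hybrid experiments -/

section

namespace Full

variable {N : ℕ} {M S : Set Str} {σ : Type} {F : (Fin N → Option M) → Option S} {E : PKE}
  {com : ℕ → Str → Str → Str} {enc : ProofSystem (EncStatement N) EncWitness}
  {dec : ProofSystem (DecStatement N) DecWitness} {A : EVote.Adversary N PubKey Ballot Str σ}

/-- The experiment after the query, when the `l`-th ciphertext of the honest ballot with index `j`
is given. -/
def completeCt (F : (Fin N → Option M) → Option S) (E : PKE)
    (enc : ProofSystem (EncStatement N) EncWitness)
    (dec : ProofSystem (DecStatement N) DecWitness)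
    (A : EVote.Adversary N PubKey Ballot Str σ) (i : Fin 2 → Fin 3) (h : Fin N → Sampler N)
    (j : Fin N) (β : Fin 3 → Bool) (l : Fin 3) (κ : ℕ) (v : View N σ) (ct : Str) : PMF Bool :=
  (sampleAll (Function.update (fun l' => (coins κ).map
      (E.encrypt κ (v.1.1.1.1 l') (cleanVote F (v.2.1.2.1 (β l') j)))) l (PMF.pure ct))).bind
    fun Ct => ((enc.prove κ (j, Ct, v.1.1.1.1, v.1.1.1.2) (none, fun _ => [], v.1.1.2)).map
      fun π => (Ct, π)).bind (complete F E enc dec A i h j κ v)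

/-- The adversary against the encryption scheme, for the `l`-th ciphertext of the honest ballot
with index `j`. -/
def cpaAdversary (F : (Fin N → Option M) → Option S) (E : PKE) (com : ℕ → Str → Str → Str)
    (enc : ProofSystem (EncStatement N) EncWitness)
    (dec : ProofSystem (DecStatement N) DecWitness)
    (A : EVote.Adversary N PubKey Ballot Str σ) (i : Fin 2 → Fin 3) (h : Fin N → Sampler N)
    (j : Fin N) (β : Fin 3 → Bool) (l : Fin 3) : PKE.CPAAdversary (View N σ) where
  choose κ pk := (coins κ).bind fun u =>
    (sampleAll (Function.update (fun _ : Fin 3 => coins κ) l (PMF.pure []))).bind fun s =>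
      (A.query κ (Function.update (pubKeys E κ s) l pk, com κ [false] u)).map fun x =>
        (fun b => cleanVote F (x.1.2.1 b j),
          ((((Function.update (pubKeys E κ s) l pk, com κ [false] u), u), s), x))
  guess κ c := completeCt F E enc dec A i h j β l κ c.1 c.2

/-- Neither decryption nor the tally witness involves the `l`-th key pair, which is why the
reduction can finish the experiment without its secret key. -/
theorem finish_update_coins {i : Fin 2 → Fin 3} {l : Fin 3} (hl : ∀ k, i k ≠ l) (κ : ℕ)
    (P : OpenedKey) (s : Fin 3 → Str) (a : Str) (x : Query N Ballot × σ)
    (B : Fin N → Option Ballot) :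
    finish F E enc dec A κ i (((P, Function.update s l a), x), B) =
      finish F E enc dec A κ i (((P, s), x), B) := by
  have hd : ∀ k, decVotes E enc κ (i k) ((P, Function.update s l a), x) =
      decVotes E enc κ (i k) ((P, s), x) := fun k => by
    unfold decVotes
    simp only [Function.update_of_ne (hl k)]
  have hg : gate F E enc κ i ((P, Function.update s l a), x) =
      gate F E enc κ i ((P, s), x) := by
    unfold gate
    rw [hd, hd]
  have hr : result F E enc κ (i 0) ((P, Function.update s l a), x) =
      result F E enc κ (i 0) ((P, s), x) := by
    unfold result
    rw [hd]
  have hw : decWitness E κ i (((P, Function.update s l a), x), B) =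
      decWitness E κ i (((P, s), x), B) := by
    unfold decWitness
    simp only [Function.update_of_ne (hl _)]
  unfold finish decStatement respond
  dsimp only
  rw [hg, hr, hw]

/-- The `l`-th ciphertext is drawn first, as the challenge; the value of `β` at `l` then plays no
role. -/
theorem afterQuery_trapdoor (i : Fin 2 → Fin 3) (h : Fin N → Sampler N) (j : Fin N)
    (β : Fin 3 → Bool) (l : Fin 3) (b : Bool) (κ : ℕ) (v : View N σ) :
    afterQuery F E enc dec A i (Function.update h j
        (trapdoor F E enc (Function.update β l b) j)) κ v =
      (coins κ).bind fun r => completeCt F E enc dec A i h j β l κ v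
        (E.encrypt κ (v.1.1.1.1 l) (cleanVote F (v.2.1.2.1 b j)) r) := by
  rw [afterQuery_update, trapdoor, sampleAll_eq_bind _ l, PMF.bind_map, PMF.bind_bind,
    PMF.bind_bind]
  congr 1
  funext r
  unfold completeCt
  rw [Function.comp_apply]
  dsimp only
  rw [Function.update_self]
  congr 2
  funext l'
  by_cases hl : l' = l
  · subst hl; simp
  · simp only [Function.update_of_ne hl]

theorem completeCt_update_coins {i : Fin 2 → Fin 3} {l : Fin 3} (hl : ∀ k, i k ≠ l)
    (h : Fin N → Sampler N) (j : Fin N) (β : Fin 3 → Bool) (κ : ℕ)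
    (P : OpenedKey) (s : Fin 3 → Str) (a : Str) (x : Query N Ballot × σ) (ct : Str) :
    completeCt F E enc dec A i h j β l κ ((P, Function.update s l a), x) ct =
      completeCt F E enc dec A i h j β l κ ((P, s), x) ct := by
  unfold completeCt complete
  simp only [finish_update_coins hl]

/-- The sampling order of `cpaGame`: the challenge key comes first, and everything else is sampled
around it. -/
theorem view_eq (l : Fin 3) (z : Bool) (κ : ℕ) : view E com A z κ =
    (coins κ).bind fun a => (coins κ).bind fun u =>
      (sampleAll (Function.update (fun _ : Fin 3 => coins κ) l (PMF.pure []))).bind fun s =>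
        (A.query κ (Function.update (pubKeys E κ s) l (E.setup κ a).1, com κ [z] u)).map fun x =>
          ((((Function.update (pubKeys E κ s) l (E.setup κ a).1, com κ [z] u), u),
            Function.update s l a), x) := by
  rw [PMF.bind_comm, view]
  congr 1
  funext u
  rw [viewFrom, sampleAll_eq_bind _ l, PMF.bind_bind]
  congr 1
  funext a
  have hpk : ∀ s, pubKeys E κ (Function.update s l a) =
      Function.update (pubKeys E κ s) l (E.setup κ a).1 := fun s => by
    funext l'
    by_cases h : l' = l
    · subst h; simp [pubKeys]
    · simp [pubKeys, h]
  rw [sampleAll_update_pure _ l a [], PMF.bind_map]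
  congr 1
  funext s
  rw [Function.comp_apply, hpk]

/-- The simulation is exact: the two sides differ only in the coins recorded for the key `l`, which
`completeCt` does not see. -/
theorem hyb_eq_cpaGame {i : Fin 2 → Fin 3} {l : Fin 3} (hl : ∀ k, i k ≠ l)
    (h : Fin N → Sampler N) (j : Fin N) (β : Fin 3 → Bool) (b : Bool) (κ : ℕ) :
    hyb F E com enc dec A false i
        (Function.update h j (trapdoor F E enc (Function.update β l b) j)) κ =
      E.cpaGame (cpaAdversary F E com enc dec A i h j β l) b κ := by
  change _ = (coins κ).bind fun a => ((cpaAdversary F E com enc dec A i h j β l).choose κ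
    (E.setup κ a).1).bind fun x => (coins κ).bind fun r =>
      completeCt F E enc dec A i h j β l κ x.2
        (E.encrypt κ (E.setup κ a).1 (x.1 b) r)
  rw [hyb, view_eq l, PMF.bind_bind]
  congr 1
  funext a
  unfold cpaAdversary
  dsimp only
  rw [PMF.bind_bind, PMF.bind_bind]
  congr 1
  funext u
  rw [PMF.bind_bind, PMF.bind_bind]
  congr 1
  funext s
  rw [PMF.bind_map, PMF.bind_map]
  congr 1
  funext x
  rw [Function.comp_apply, Function.comp_apply, afterQuery_trapdoor]
  simp only [completeCt_update_coins hl, Function.update_self]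

variable [Coded σ]

theorem ppt_completeCt (H : Assumptions F E com enc dec) (hA : A.IsPPT) (i : Fin 2 → Fin 3)
    {h : Fin N → Sampler N} (hh : ∀ j, PPT (h j)) (j : Fin N) (β : Fin 3 → Bool) (l : Fin 3) :
    PPT fun κ (c : View N σ × Str) => completeCt F E enc dec A i h j β l κ c.1 c.2 := by
  refine .bind (.sampleAll (p := fun l' κ (c : View N σ × Str) => Function.update
    (fun l' => (coins κ).map (E.encrypt κ (c.1.1.1.1.1 l')
      (cleanVote F (c.1.2.1.2.1 (β l') j)))) l (PMF.pure c.2) l') fun l' => ?_) (.bind ?_ ?_)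
  · by_cases hl : l' = l
    · subst hl
      simp only [Function.update_self]
      exact PolyTime.id.snd
    · simp only [Function.update_of_ne hl]
      exact (ppt_encrypt H).comp ((PolyTime.id.fst.fst.fst.fst.fst.apply l').pair
        (polyTime_cleanVote H ((PolyTime.id.fst.snd.fst.snd.fst.boolApply (β l')).apply j)))
  · exact (ppt_trapdoor_prove H j).comp
      ((PolyTime.id.fst.fst.fst.fst.pair PolyTime.id.fst.fst.snd.fst).pair PolyTime.id.snd)
  · exact (ppt_complete H hA i hh j).comp (PolyTime.id.fst.fst.fst.pair PolyTime.id.snd)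

theorem cpaAdversary_legal (H : Assumptions F E com enc dec) (hA : A.IsPPT) (i : Fin 2 → Fin 3)
    {h : Fin N → Sampler N} (hh : ∀ j, PPT (h j)) (j : Fin N) (β : Fin 3 → Bool) (l : Fin 3) :
    (cpaAdversary F E com enc dec A i h j β l).Legal E where
  choose := by
    have hs : PPT fun κ (_ : Str × Str) =>
        sampleAll (Function.update (fun _ : Fin 3 => coins κ) l (PMF.pure [])) := by
      refine .sampleAll (p := fun l' κ (_ : Str × Str) =>
        Function.update (fun _ : Fin 3 => coins κ) l (PMF.pure []) l') fun l' => ?_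
      by_cases hl : l' = l
      · subst hl
        simp only [Function.update_self]
        exact .const []
      · simp only [Function.update_of_ne hl]
        exact .coins
    have hpk : PolyTime fun κ (y : (Str × Str) × (Fin 3 → Str)) =>
        ((Function.update (pubKeys E κ y.2) l y.1.1, com κ [false] y.1.2) : PubKey) := by
      refine .pair (.tuple (f := fun l' κ (y : (Str × Str) × (Fin 3 → Str)) =>
        Function.update (pubKeys E κ y.2) l y.1.1 l') fun l' => ?_)
        (H.commitment.efficient.comp ((PolyTime.const [false]).pair PolyTime.id.fst.snd))
      by_cases hl : l' = l
      · subst hl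
        simp only [Function.update_self]
        exact PolyTime.id.fst.fst
      · simp only [Function.update_of_ne hl]
        exact (H.efficient.setup.comp (PolyTime.id.snd.apply l')).fst
    refine .bind .coins (.bind hs (.map (hA.query.comp hpk) (.pair ?_ ?_)))
    · exact .boolTuple fun b => polyTime_cleanVote H
        ((PolyTime.id.snd.fst.snd.fst.boolApply b).apply j)
    · exact (((hpk.comp PolyTime.id.fst).pair PolyTime.id.fst.fst.snd).pair
        PolyTime.id.fst.snd).pair PolyTime.id.snd
  guess := ppt_completeCt H hA i hh j β l
  mem_msg := by
    intro κ pk x hx b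
    simp only [cpaAdversary, PMF.mem_support_bind_iff, PMF.support_map, Set.mem_image] at hx
    obtain ⟨u, -, s, -, y, -, rfl⟩ := hx
    exact H.msg (cleanVote_mem H _)

/-- Changing the votes in the `l`-th ciphertexts, when these are not used in the tally. -/
theorem indist_hyb_votes (H : Assumptions F E com enc dec) (hA : A.IsPPT) {i : Fin 2 → Fin 3}
    {l : Fin 3} (hl : ∀ k, i k ≠ l) (β : Fin 3 → Bool) :
    Indist (hyb F E com enc dec A false i (trapdoor F E enc (Function.update β l false)))
      (hyb F E com enc dec A false i (trapdoor F E enc (Function.update β l true))) := by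
  refine Indist.hybrid (hyb F E com enc dec A false i) (fun h => PPT h)
    (fun j => ppt_trapdoor H _ j) (fun j => ppt_trapdoor H _ j) fun h hh j => ?_
  refine Indist.of_le (H.cpa _ _ (cpaAdversary_legal H hA i hh j β l)) fun κ => ?_
  rw [hyb_eq_cpaGame hl, hyb_eq_cpaGame hl]

theorem indist_hyb_trapdoor (H : Assumptions F E com enc dec) (hA : A.IsPPT) (i : Fin 2 → Fin 3)
    (b : Bool) : Indist (hyb F E com enc dec A true i (ordinary F E enc b))
      (hyb F E com enc dec A false i (trapdoor F E enc fun _ => b)) :=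
  (indist_hyb_commitment H hA i b).trans
    (Indist.hybrid (hyb F E com enc dec A false i) (fun h => PPT h)
      (fun j => ppt_ordinary H b j) (fun j => ppt_trapdoor H _ j)
      fun _ hh j => indist_hyb_witness H hA i hh j b)

/-- The ciphertexts are changed in the order third, second, first, each while the tally uses the
other two keys; a last change of keys returns to the first two. -/
theorem indist_hyb (H : Assumptions F E com enc dec) (hA : A.IsPPT) :
    Indist (hyb F E com enc dec A true ![0, 1] (ordinary F E enc false))
      (hyb F E com enc dec A true ![0, 1] (ordinary F E enc true)) := by
  refine (indist_hyb_trapdoor H hA _ false).trans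
    (Indist.trans ?_ (indist_hyb_trapdoor H hA _ true).symm)
  have h1 := indist_hyb_votes H hA (i := ![0, 1]) (l := 2) (by decide) fun _ => false
  have h2 := indist_hyb_keys H hA (i := ![0, 1]) (i' := ![0, 2]) (by decide) (by decide)
    ![false, false, true]
  have h3 := indist_hyb_votes H hA (i := ![0, 2]) (l := 1) (by decide) ![false, false, true]
  have h4 := indist_hyb_keys H hA (i := ![0, 2]) (i' := ![1, 2]) (by decide) (by decide)
    ![false, true, true]
  have h5 := indist_hyb_votes H hA (i := ![1, 2]) (l := 0) (by decide) ![false, true, true]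
  have h6 := indist_hyb_keys H hA (i := ![1, 2]) (i' := ![0, 1]) (by decide) (by decide)
    fun _ => true
  have e1 : Function.update (fun _ : Fin 3 => false) 2 false = fun _ => false := by decide
  have e2 : Function.update (fun _ : Fin 3 => false) 2 true = ![false, false, true] := by decide
  have e3 : Function.update ![false, false, true] 1 false = ![false, false, true] := by decide
  have e4 : Function.update ![false, false, true] 1 true = ![false, true, true] := by decide
  have e5 : Function.update ![false, true, true] 0 false = ![false, true, true] := by decide
  have e6 : Function.update ![false, true, true] 0 true = fun _ => true := by decide
  rw [e1, e2] at h1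
  rw [e3, e4] at h3
  rw [e5, e6] at h5
  exact h1.trans (h2.trans (h3.trans (h4.trans (h5.trans h6))))

end Full

end

section

namespace Full

variable {N : ℕ} {M S : Set Str} {σ : Type} {F : (Fin N → Option M) → Option S} {E : PKE}
  {com : ℕ → Str → Str → Str} {enc : ProofSystem (EncStatement N) EncWitness}
  {dec : ProofSystem (DecStatement N) DecWitness} {A : EVote.Adversary N PubKey Ballot Str σ}

/-! ### The privacy game -/

/-- The secret key that belongs to a view. -/
def secKey (E : PKE) (κ : ℕ) (v : View N σ) : SecKey :=
  (fun l => (E.setup κ (v.1.2 l.castSucc)).2, fun l => v.1.2 l.castSucc, v.1.1.2)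

/-- The privacy game after the query, up to the output of the adversary. -/
def realAfterQuery (F : (Fin N → Option M) → Option S) (E : PKE) (com : ℕ → Str → Str → Str)
    (enc : ProofSystem (EncStatement N) EncWitness)
    (dec : ProofSystem (DecStatement N) DecWitness)
    (A : EVote.Adversary N PubKey Ballot Str σ) (b : Bool) (κ : ℕ) (v : View N σ) : PMF Bool :=
  ((evoteFull F E com enc dec).challengeBallots κ v.1.1.1 v.2.1 b).bind fun B =>
    (evalTally F E enc dec κ v.1.1.1 (secKey E κ v) B).bind fun t =>
      A.guess κ (v.2.2, B, t.1, t.2)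

open Classical in
-- The query does not depend on `b`, so the bit may be drawn after it, and each view can be treated
-- separately.
theorem privGame_eq (κ : ℕ) : EVote.privGame F (evoteFull F E com enc dec) A κ =
    (view E com A true κ).bind fun v => (PMF.uniformOfFintype Bool).bind fun b =>
      (realAfterQuery F E com enc dec A b κ v).bind fun b' =>
        PMF.pure (decide (b' = b ∧ EVote.ValidQuery F v.2.1)) := by
  have h1 : EVote.privGame F (evoteFull F E com enc dec) A κ =
      (setup E com κ).bind fun k => (PMF.uniformOfFintype Bool).bind fun b =>
        (A.query κ k.1).bind fun x =>
          ((evoteFull F E com enc dec).challengeBallots κ k.1 x.1 b).bind fun B =>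
            (evalTally F E enc dec κ k.1 k.2 B).bind fun t =>
              (A.guess κ (x.2, B, t.1, t.2)).bind fun b' =>
                PMF.pure (decide (b' = b ∧ EVote.ValidQuery F x.1)) := rfl
  have h2 : setup E com κ = (coins κ).bind fun u => (sampleAll fun _ : Fin 3 => coins κ).bind
      fun s => PMF.pure ((pubKeys E κ s, com κ [true] u),
        (fun l => (E.setup κ (s l.castSucc)).2, fun l => s l.castSucc, u)) := rfl
  rw [h1, h2, view]
  simp only [viewFrom, PMF.bind_bind, PMF.pure_bind]
  congr 1
  funext u
  congr 1
  funext s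
  rw [PMF.bind_comm, PMF.bind_map]
  congr 1
  funext x
  rw [Function.comp_apply]
  congr 1
  funext b
  simp only [realAfterQuery, PMF.bind_bind]
  rfl

theorem votesWith_clean (d : Fin N → Option Str) (q : Query N Ballot) (b : Bool) :
    tally F (votesWith d q b) =
      (F fun j => if q.1 j = true then clean M (d j) else clean M (q.2.1 b j)).map
        Subtype.val := by
  unfold tally votesWith
  congr 2
  funext j
  split_ifs <;> rfl

/-- Validity is applied with `d` the decrypted votes, cleaned; these agree for all keys because the
commitment is to `1`. -/
theorem gate_of_validQuery (H : Assumptions F E com enc dec) {κ : ℕ} {v : View N σ}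
    (hv : IsView E com true κ v) (hq : EVote.ValidQuery F v.2.1) :
    gate F E enc κ ![0, 1] v = true := by
  obtain ⟨h1, h2, h3⟩ := hq
  have hb := bad_eq_false H hv
  refine gate_eq_true_iff.2 ⟨?_, h1, fun j hj b => cleanVote_of_mem H (h2 j hj b), ?_⟩
  · exact (decVotes_eq_of_not_bad hb _).trans (decVotes_eq_of_not_bad hb _).symm
  · rw [votesWith_clean, votesWith_clean, h3]

/-- The gate suffices here, without full validity: it makes cleaning the honest votes harmless, the
dishonest ballots independent of `b`, and the two decrypted tallies equal to `result`. -/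
theorem realAfterQuery_eq (H : Assumptions F E com enc dec) {κ : ℕ} {v : View N σ}
    (hv : IsView E com true κ v) (hg : gate F E enc κ ![0, 1] v = true) (b : Bool) :
    realAfterQuery F E com enc dec A b κ v =
      afterQuery F E enc dec A ![0, 1] (ordinary F E enc b) κ v := by
  have hg' := gate_eq_true_iff.1 hg
  have hballots : (evoteFull F E com enc dec).challengeBallots κ v.1.1.1 v.2.1 b =
      ballots enc (ordinary F E enc b) κ v := by
    unfold EVote.challengeBallots ballots
    congr 1
    funext j
    unfold slot
    dsimp only
    by_cases hS : v.2.1.1 j = true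
    · rw [if_pos hS, if_pos hS]
      have hbb : v.2.1.2.2 b j = v.2.1.2.2 false j := by
        cases b
        · rfl
        · exact (hg'.2.1 j hS).symm
      rw [hbb]
      rfl
    · rw [if_neg hS, if_neg hS]
      have hm := hg'.2.2.1 j (by simpa using hS) b
      unfold ordinary
      dsimp only
      rw [hm]
      rfl
  unfold realAfterQuery afterQuery
  rw [hballots]
  refine bind_congr fun B hB => ?_
  -- Dishonest ballots have been filtered already, and honest ones are accepted by perfect
  -- completeness.
  have hfilter : filterBallots enc κ v.1.1.1 B = B := by
    funext j
    have hj := mem_support_sampleAll.1 hB j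
    unfold slot at hj
    unfold filterBallots
    dsimp only at hj ⊢
    split_ifs at hj
    · rw [PMF.support_pure, Set.mem_singleton_iff] at hj
      rw [hj, accepted, Option.filter_filter]
      congr 1
      funext a
      simp
    · rw [PMF.support_map] at hj
      obtain ⟨a, ha, haj⟩ := hj
      have hver := (ordinary_sound H ha).2
      dsimp only at hver
      rw [← haj, Option.filter_some, if_pos hver]
  have htally : ∀ l : Fin 2, tallyAt F E κ (![0, 1] l) (E.setup κ (v.1.2 (![0, 1] l))).2 B =
      result F E enc κ 0 v := fun l =>
    (result_eq_tallyAt H hv hg (fun j a ha => (ordinary_sound H ha).1) hB l).symm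
  have h0 : tallyAt F E κ 0 ((secKey E κ v).1 0) B = result F E enc κ 0 v := htally 0
  have h1 : tallyAt F E κ 1 ((secKey E κ v).1 1) B = result F E enc κ 0 v := htally 1
  have hw : ((secKey E κ v).1, (secKey E κ v).2.1, ![0, 1]) =
      decWitness E κ ![0, 1] (v, B) := by
    have hc : ∀ l : Fin 2, l.castSucc = (![0, 1] : Fin 2 → Fin 3) l := by decide
    unfold secKey decWitness
    simp only [hc]
  unfold finish evalTally
  rw [if_pos hg]
  dsimp only
  rw [hfilter, h0, h1, if_pos rfl, hw]
  by_cases hB0 : ∀ j, B j = none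
  · have hB0' : B = fun _ => none := funext hB0
    rw [if_pos hB0, PMF.pure_bind]
    -- The scheme makes no proof here, while `finish` draws one and ignores it.
    have hresp : respond F E enc A κ ![0, 1] (v, B) =
        fun _ => A.guess κ (v.2.2, B, none, none) := by
      funext γ
      unfold respond
      dsimp only
      rw [if_pos (by simpa using hB0')]
    rw [hresp, PMF.bind_const]
  · have hB0' : ¬ B = fun _ => none := fun h => hB0 fun j => by rw [h]
    rw [if_neg hB0, PMF.bind_map]
    congr 1
    funext γ
    unfold respond
    dsimp only [Function.comp_apply]
    rw [if_neg (by simpa using hB0')]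
    rfl

open Classical in
/-- The contribution of a valid query to the winning probability. -/
theorem Pr_win_of_valid (H : Assumptions F E com enc dec) {κ : ℕ} {v : View N σ}
    (hv : IsView E com true κ v) (hq : EVote.ValidQuery F v.2.1) :
    Pr ((PMF.uniformOfFintype Bool).bind fun b =>
      (realAfterQuery F E com enc dec A b κ v).bind fun b' =>
        PMF.pure (decide (b' = b ∧ EVote.ValidQuery F v.2.1))) =
    1 / 2 + 1 / 2 * (Pr (afterQuery F E enc dec A ![0, 1] (ordinary F E enc true) κ v) -
      Pr (afterQuery F E enc dec A ![0, 1] (ordinary F E enc false) κ v)) := by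
  have hr := realAfterQuery_eq (A := A) H hv (gate_of_validQuery H hv hq)
  have hf : (fun b' => PMF.pure (decide (b' = false ∧ EVote.ValidQuery F v.2.1))) =
      fun b' => PMF.pure (!b') := by
    funext b'
    cases b' <;> simp [hq]
  have ht : (fun b' => PMF.pure (decide (b' = true ∧ EVote.ValidQuery F v.2.1))) =
      PMF.pure := by
    funext b'
    cases b' <;> simp [hq]
  rw [Pr_bind_uniform, hf, ht, Pr_map_not, PMF.bind_pure, hr, hr]
  ring

open Classical in
-- An invalid query never wins, and the right-hand side is nonnegative because the difference of
-- probabilities is at least `-1`. Equality fails in general for such queries, so the unconditional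
-- bound is one-sided.
theorem Pr_win_le (H : Assumptions F E com enc dec) {κ : ℕ} {v : View N σ}
    (hv : IsView E com true κ v) :
    Pr ((PMF.uniformOfFintype Bool).bind fun b =>
      (realAfterQuery F E com enc dec A b κ v).bind fun b' =>
        PMF.pure (decide (b' = b ∧ EVote.ValidQuery F v.2.1))) ≤
    1 / 2 + 1 / 2 * (Pr (afterQuery F E enc dec A ![0, 1] (ordinary F E enc true) κ v) -
      Pr (afterQuery F E enc dec A ![0, 1] (ordinary F E enc false) κ v)) := by
  by_cases hq : EVote.ValidQuery F v.2.1
  · exact (Pr_win_of_valid H hv hq).le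
  · simp only [hq, and_false, decide_false, PMF.bind_const, Pr_pure]
    have h1 := Pr_nonneg (afterQuery F E enc dec A ![0, 1] (ordinary F E enc true) κ v)
    have h2 := Pr_le_one (afterQuery F E enc dec A ![0, 1] (ordinary F E enc false) κ v)
    rw [if_neg (by simp)]
    linarith

theorem indSecure (H : Assumptions F E com enc dec) :
    EVote.INDSecure F (evoteFull F E com enc dec) := by
  classical
  intro σ _ A hA
  have hneg := indist_hyb H hA
  have hle : ∀ κ, Pr (EVote.privGame F (evoteFull F E com enc dec) A κ) ≤ 1 / 2 + 1 / 2 *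
      (Pr (hyb F E com enc dec A true ![0, 1] (ordinary F E enc true) κ) -
        Pr (hyb F E com enc dec A true ![0, 1] (ordinary F E enc false) κ)) := fun κ => by
    rw [privGame_eq]
    exact Pr_bind_mono _ _ fun v hv => Pr_win_le H (isView_of_mem hv)
  have habs : ∀ x y : ℝ, |1 / 2 * (x - y)| ≤ |y - x| := fun x y => by
    rw [abs_mul, abs_sub_comm, abs_of_pos (by norm_num : (0 : ℝ) < 1 / 2)]
    linarith [abs_nonneg (y - x)]
  refine ⟨⟨_, hneg, fun κ => ?_⟩, fun hvalid => hneg.mono fun κ => ?_⟩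
  · have h1 := hle κ
    have h2 := (le_abs_self _).trans
      (habs (Pr (hyb F E com enc dec A true ![0, 1] (ordinary F E enc true) κ))
        (Pr (hyb F E com enc dec A true ![0, 1] (ordinary F E enc false) κ)))
    linarith
  · have h1 : 1 / 2 + 1 / 2 *
        (Pr (hyb F E com enc dec A true ![0, 1] (ordinary F E enc true) κ) -
          Pr (hyb F E com enc dec A true ![0, 1] (ordinary F E enc false) κ)) ≤
        Pr (EVote.privGame F (evoteFull F E com enc dec) A κ) := by
      rw [privGame_eq]
      -- If every query is valid, the bound is an equality for each view, which gives the reverse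
      -- inequality.
      refine Pr_bind_anti _ _ fun v hv => (Pr_win_of_valid H (isView_of_mem hv) ?_).ge
      simp only [view, viewFrom, PMF.mem_support_bind_iff, PMF.support_map, Set.mem_image] at hv
      obtain ⟨u, hu, s, hs, x, hx, rfl⟩ := hv
      refine hvalid κ ((pubKeys E κ s, com κ [true] u),
        (fun l => (E.setup κ (s l.castSucc)).2, fun l => s l.castSucc, u)) ?_ x hx
      change _ ∈ ((coins κ).bind fun u => (sampleAll fun _ : Fin 3 => coins κ).bind
        fun s => PMF.pure ((pubKeys E κ s, com κ [true] u),
          ((fun l => (E.setup κ (s l.castSucc)).2, fun l => s l.castSucc, u) : SecKey))).support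
      simp only [PMF.mem_support_bind_iff]
      exact ⟨u, hu, s, hs, by simp⟩
    rw [abs_abs, le_antisymm (hle κ) h1, add_sub_cancel_left]
    exact habs _ _

end Full

end

end EVoting

end

theorem mainTheorem2 (N : ℕ) (hN : 0 < N) (M S : Set EVoting.Str)
    (F : (Fin N → Option M) → Option S) (hF : EVoting.IsTallyFunction F)
    (hF_efficient : EVoting.PolyTime fun (_ : ℕ) (v : Fin N → Option EVoting.Str) =>
      EVoting.tally F v)
    (E : EVoting.PKE) (hE_msg : EVoting.votes M ⊆ E.msg) (hE_efficient : E.Efficient)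
    (hE_correct : E.PerfectlyCorrect) (hE_unique : E.UniqueSecretKey) (hE_cpa : E.INDCPA)
    (com : ℕ → EVoting.Str → EVoting.Str → EVoting.Str) (hcom : EVoting.IsCommitment com)
    (enc : EVoting.ProofSystem (EVoting.Full.EncStatement N) EVoting.Full.EncWitness)
    (henc : EVoting.IsNIWI (EVoting.Full.encRel M E com) enc)
    (dec : EVoting.ProofSystem (EVoting.Full.DecStatement N) EVoting.Full.DecWitness)
    (hdec : EVoting.IsNIWI (EVoting.Full.decRel F E) dec) :
    EVoting.EVote.INDSecure F (EVoting.evoteFull F E com enc dec) := by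
  exact EVoting.Full.indSecure ⟨hN, hF, hF_efficient, hE_msg, hE_efficient, hE_correct, hE_cpa,
    hcom, henc, hdec⟩
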